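/- Let $A$ be a Banach algebra over $\mathbb{K}=\mathbb{R}$ or $\mathbb{C}$ (not necessarily unital), let $G$ be a locally compact Hausdorff group with left Haar measure $ds$ and modular function $\Delta$ (normalised by $\Delta(r)\int_G h(sr)\,ds=\int_G h(s)\,ds$ for $h\in C_c(G)$), and let $\alpha$ be a strongly continuous action of $G$ on $A$ by bounded algebra automorphisms. Assume that for each $\varepsilon>0$ the algebra $A$ has a $(1+\varepsilon)$-bounded approximate left identity, i.e. a net $(u_i)$ in $A$ with $\|u_i\|\le 1+\varepsilon$ and $u_ia\to a$ for all $a\in A$. A continuous covariant representation of $(A,G,\alpha)$ on a Banach space $X$ is a pair $(\pi,U)$ of a bounded algebra homomorphism $\pi:A\to B(X)$ and a strongly continuous homomorphism $U$ of $G$ into the invertible elements of $B(X)$ such that $\pi(\alpha_s(a))=U_s\pi(a)U_s^{-1}$ for all $a\in A$, $s\in G$. A representation $T$ of an algebra on $X$ is non-degenerate if the linear span of all $T(b)x$ is dense in $X$, and $(\pi,U)$ is non-degenerate if $\pi$ is. Let $\mathcal{X}$ be a class of Banach spaces over $\mathbb K$, and let $\mathcal{R}$ consist of all non-degenerate continuous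 covariant representations $(\pi,U)$ of $(A,G,\alpha)$ on spaces from $\mathcal{X}$ such that $\pi$ is contractive and $U_r$ is an isometry for all $r\in G$. Suppose that $\mathcal{R}$ is non-empty. Equip $C_c(G,A)$ with the product $(f*g)(s)=\int_G f(r)\,\alpha_r(g(r^{-1}s))\,dr$. For $(\pi,U)\in\mathcal{R}$ put $\pi\rtimes U(f)=\int_G\pi(f(s))U_s\,ds$ (strongly convergent integral), and let $\sigma^{\mathcal{R}}(f)=\sup_{(\pi,U)\in\mathcal{R}}\|\pi\rtimes U(f)\|$, which is an algebra seminorm. The crossed product $(A\rtimes_\alpha G)^{\mathcal{R}}$ is the Banach algebra obtained by completing $C_c(G,A)/\ker\sigma^{\mathcal{R}}$ in the norm induced by $\sigma^{\mathcal{R}}$; let $q^{\mathcal{R}}$ be the canonical map of $C_c(G,A)$ into it. For $(\pi,U)\in\mathcal{R}$ let $(\pi\rtimes U)^{\mathcal{R}}$ be the contractive representation of $(A\rtimes_\alpha G)^{\mathcal{R}}$ determined by $(\pi\rtimes U)^{\mathcal{R}}(q^{\mathcal{R}}(f))=\pi\rtimes U(f)$. Then the map $(\pi,U)\mapsto(\pi\rtimes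 U)^{\mathcal{R}}$ is a bijection between $\mathcal{R}$ and the non-degenerate contractive representations of $(A\rtimes_\alpha G)^{\mathcal{R}}$ on spaces from $\mathcal{X}$. It preserves the set of closed invariant subspaces (a closed subspace is invariant under all $\pi(a)$ and all $U_s$ if and only if it is invariant under $(\pi\rtimes U)^{\mathcal{R}}$), as well as the space of bounded intertwining operators between two elements of $\mathcal{R}$ (a bounded operator intertwines $(\pi,U)$ and $(\rho,V)$, i.e. intertwines both $\pi$ with $\rho$ and $U$ with $V$, if and only if it intertwines $(\pi\rtimes U)^{\mathcal{R}}$ and $(\rho\rtimes V)^{\mathcal{R}}$). Moreover, suppose that $A$ has a bounded (conjugate-linear) involution, that each $\alpha_s$ is involutive, and that every $(\pi,U)\in\mathcal{R}$ is involutive, i.e. its space is a Hilbert space, $\pi(a^*)=\pi(a)^*$ for all $a\in A$, and every $U_s$ is unitary. Then the bijection preserves the property of being involutive, where $(A\rtimes_\alpha G)^{\mathcal{R}}$ carries the continuous extension of the involution induced by $f^*(s)=\Delta(s^{-1})\,\alpha_s(f(s^{-1})^*)$ on $C_c(G,A)$, and a representation $T$ of it on a Hilbert space is involutive if $T(b^*)=T(b)^*$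 for all $b$. -/

import Mathlib

open MeasureTheory Filter Topology Set
open scoped CompactlySupported

universe v w

set_option linter.unusedSectionVars false

namespace CrossedProd

section Integral

variable (𝕜 : Type*) [RCLike 𝕜] {G : Type*} [MeasurableSpace G]
  {E : Type*} [NormedAddCommGroup E] [NormedSpace 𝕜 E]
  {F : Type*} [NormedAddCommGroup F] [NormedSpace 𝕜 F]

/-- The Bochner integral over `G` of a function with values in a normed space over `𝕜`, which is
viewed as a real normed space by restriction of scalars. -/
noncomputable def vint (μ : Measure G) (f : G → E) : E :=
  letI : NormedSpace ℝ E := NormedSpace.restrictScalars ℝ 𝕜 E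
  ∫ s, f s ∂μ

theorem vint_eq_integral [h : NormedSpace ℝ E] [IsScalarTower ℝ 𝕜 E] (μ : Measure G) (f : G → E) :
    vint 𝕜 μ f = ∫ s, f s ∂μ := by
  have e : NormedSpace.restrictScalars ℝ 𝕜 E = h := by
    have h2 : (NormedSpace.restrictScalars ℝ 𝕜 E).toModule = h.toModule := by
      refine Module.ext' _ _ fun r x => ?_
      exact algebraMap_smul 𝕜 r x
    cases h
    cases h2
    rfl
  rw [vint, e]

theorem vint_zero (μ : Measure G) : vint 𝕜 μ (fun _ => (0 : E)) = 0 :=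
  let _ : NormedSpace ℝ E := NormedSpace.restrictScalars ℝ 𝕜 E
  integral_zero G E

theorem norm_vint_le (μ : Measure G) (f : G → E) : ‖vint 𝕜 μ f‖ ≤ ∫ s, ‖f s‖ ∂μ :=
  let _ : NormedSpace ℝ E := NormedSpace.restrictScalars ℝ 𝕜 E
  norm_integral_le_integral_norm f

variable [TopologicalSpace G] [OpensMeasurableSpace G] {μ : Measure G}
  [IsFiniteMeasureOnCompacts μ]

theorem vint_add {f g : G → E} (hf : Continuous f) (hf' : HasCompactSupport f)
    (hg : Continuous g) (hg' : HasCompactSupport g) :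
    vint 𝕜 μ (fun s => f s + g s) = vint 𝕜 μ f + vint 𝕜 μ g :=
  let _ : NormedSpace ℝ E := NormedSpace.restrictScalars ℝ 𝕜 E
  integral_add (hf.integrable_of_hasCompactSupport hf') (hg.integrable_of_hasCompactSupport hg')

theorem map_vint [CompleteSpace E] [CompleteSpace F] (L : E →L[𝕜] F) {f : G → E}
    (hf : Continuous f) (hf' : HasCompactSupport f) :
    L (vint 𝕜 μ f) = vint 𝕜 μ (fun s => L (f s)) := by
  let _ : NormedSpace ℝ E := NormedSpace.restrictScalars ℝ 𝕜 E
  let _ : NormedSpace ℝ F := NormedSpace.restrictScalars ℝ 𝕜 F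
  exact (L.integral_comp_comm (hf.integrable_of_hasCompactSupport hf')).symm

theorem vint_swap {f : G → G → E} (hf : Continuous f.uncurry)
    (hf' : HasCompactSupport f.uncurry) :
    vint 𝕜 μ (fun s => vint 𝕜 μ (fun r => f s r)) =
      vint 𝕜 μ (fun r => vint 𝕜 μ (fun s => f s r)) :=
  let _ : NormedSpace ℝ E := NormedSpace.restrictScalars ℝ 𝕜 E
  integral_integral_swap_of_hasCompactSupport hf hf'

theorem continuousOn_vint {f : G → G → E} {k t : Set G} (hk : IsCompact k)
    (hf : Continuous f.uncurry) (hfs : ∀ p x, p ∈ t → x ∉ k → f p x = 0) :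
    ContinuousOn (fun p => vint 𝕜 μ (f p)) t :=
  let _ : NormedSpace ℝ E := NormedSpace.restrictScalars ℝ 𝕜 E
  continuousOn_integral_of_compact_support hk hf.continuousOn hfs

end Integral

theorem vint_mul_left (𝕜 : Type*) [RCLike 𝕜] {G : Type*} [Group G] [TopologicalSpace G]
    [IsTopologicalGroup G] [MeasurableSpace G] [BorelSpace G] {E : Type*} [NormedAddCommGroup E]
    [NormedSpace 𝕜 E] (μ : Measure G) [μ.IsMulLeftInvariant] (f : G → E) (g : G) :
    vint 𝕜 μ (fun s => f (g * s)) = vint 𝕜 μ f :=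
  let _ : NormedSpace ℝ E := NormedSpace.restrictScalars ℝ 𝕜 E
  integral_mul_left_eq_self f g

theorem exists_bound_on_compact {𝕜 : Type*} [RCLike 𝕜] {G : Type*} [TopologicalSpace G]
    {E : Type*} [NormedAddCommGroup E] [NormedSpace 𝕜 E] [CompleteSpace E]
    {φ : G → (E →L[𝕜] E)} (hφ : ∀ x, Continuous fun s => φ s x) {K : Set G} (hK : IsCompact K) :
    ∃ M : ℝ, 0 ≤ M ∧ ∀ s ∈ K, ‖φ s‖ ≤ M := by
  obtain ⟨M, hM⟩ := banach_steinhaus (g := fun s : K => φ s) (fun x => by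
    obtain ⟨C, hC⟩ := hK.exists_bound_of_continuousOn (hφ x).continuousOn
    exact ⟨C, fun s => hC s s.2⟩)
  exact ⟨max M 0, le_max_right _ _, fun s hs => (hM ⟨s, hs⟩).trans (le_max_left _ _)⟩

/-- A strongly continuous family of bounded operators on a Banach space, indexed by a locally
compact space, is jointly continuous. -/
theorem continuous_joint {𝕜 : Type*} [RCLike 𝕜] {G : Type*} [TopologicalSpace G]
    [LocallyCompactSpace G] {E : Type*} [NormedAddCommGroup E] [NormedSpace 𝕜 E] [CompleteSpace E]
    {φ : G → (E →L[𝕜] E)} (hφ : ∀ x, Continuous fun s => φ s x) :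
    Continuous fun p : G × E => φ p.1 p.2 := by
  rw [continuous_iff_continuousAt]
  rintro ⟨s, x⟩
  obtain ⟨K, hK, hKs⟩ := exists_compact_mem_nhds s
  obtain ⟨M, hM0, hM⟩ := exists_bound_on_compact hφ hK
  have h1 : Tendsto (fun p : G × E => φ p.1 x) (𝓝 (s, x)) (𝓝 (φ s x)) :=
    ((hφ x).comp continuous_fst).tendsto (s, x)
  have h2 : Tendsto (fun p : G × E => φ p.1 (p.2 - x)) (𝓝 (s, x)) (𝓝 0) := by
    have h3 : Tendsto (fun p : G × E => M * ‖p.2 - x‖) (𝓝 (s, x)) (𝓝 0) := by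
      have : Continuous fun p : G × E => M * ‖p.2 - x‖ := by fun_prop
      simpa using this.tendsto (s, x)
    refine squeeze_zero_norm' ?_ h3
    filter_upwards [continuous_fst.continuousAt.preimage_mem_nhds (x := (s, x)) hKs] with p hp
    exact ((φ p.1).le_opNorm _).trans (by gcongr; exact hM _ hp)
  have := h1.add h2
  simpa [ContinuousAt] using this

section Defs

variable {𝕜 : Type v} [RCLike 𝕜]
  {A : Type*} [NonUnitalNormedRing A] [NormedSpace 𝕜 A] [IsScalarTower 𝕜 A A]
  [SMulCommClass 𝕜 A A]
  {G : Type*} [Group G] [TopologicalSpace G]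

/-- A strongly continuous action `α` of the group `G` on the algebra `A` by bounded algebra
automorphisms. (As `α` is multiplicative with `α 1 = id`, every `α s` is invertible in `B(A)`.) -/
structure DynSys (𝕜 : Type*) [RCLike 𝕜] (A : Type*) [NonUnitalNormedRing A] [NormedSpace 𝕜 A]
    (G : Type*) [Group G] [TopologicalSpace G] where
  act : G →* (A →L[𝕜] A)
  act_mul : ∀ s a b, act s (a * b) = act s a * act s b
  continuous_act : ∀ a, Continuous fun s => act s a

/-- A covariant representation `(π, U)` of the system on the normed space `X`. (A multiplicative
map `U` with `U 1 = id` automatically has values in the invertible operators.) -/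
structure CovRep (α : DynSys 𝕜 A G) (X : Type*) [NormedAddCommGroup X] [NormedSpace 𝕜 X] where
  π : A →ₙₐ[𝕜] (X →L[𝕜] X)
  U : G →* (X →L[𝕜] X)
  covariant : ∀ a s, π (α.act s a) = U s * π a * U s⁻¹

/-- A continuous covariant representation: `π` is norm bounded, `U` is strongly continuous. -/
structure ContCovRep (α : DynSys 𝕜 A G) (X : Type*) [NormedAddCommGroup X] [NormedSpace 𝕜 X]
    extends CovRep α X where
  bounded : ∃ C : ℝ, ∀ a, ‖π a‖ ≤ C * ‖a‖
  continuous_U : ∀ x, Continuous fun s => U s x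

variable [IsTopologicalGroup G] [LocallyCompactSpace G] [T2Space G] [CompleteSpace A]
  [MeasurableSpace G] [BorelSpace G] (μ : Measure G) [μ.IsHaarMeasure]

theorem DynSys.continuous_joint (α : DynSys 𝕜 A G) :
    Continuous fun p : G × A => α.act p.1 p.2 :=
  CrossedProd.continuous_joint α.continuous_act

theorem DynSys.act_act (α : DynSys 𝕜 A G) (s t : G) (a : A) :
    α.act s (α.act t a) = α.act (s * t) a := by
  rw [map_mul]; rfl

section Convolution

variable (α : DynSys 𝕜 A G)

theorem continuous_convIntegrand (f g : C_c(G, A)) :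
    Continuous (Function.uncurry fun s r : G => f r * α.act r (g (r⁻¹ * s))) := by
  have h := α.continuous_joint.comp
    (f := fun p : G × G => (p.2, g (p.2⁻¹ * p.1))) (by fun_prop)
  exact (f.continuous.comp continuous_snd).mul h

theorem convIntegrand_eq_zero (f g : C_c(G, A)) {s r : G}
    (h : r ∉ tsupport f) : f r * α.act r (g (r⁻¹ * s)) = 0 := by
  rw [image_eq_zero_of_notMem_tsupport h, zero_mul]

theorem convIntegrand_eq_zero' (f g : C_c(G, A)) {s r : G}
    (h : s ∉ (fun p : G × G => p.1 * p.2) '' (tsupport f ×ˢ tsupport g)) :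
    f r * α.act r (g (r⁻¹ * s)) = 0 := by
  by_cases hr : r ∈ tsupport f
  · have : r⁻¹ * s ∉ tsupport g := fun h' => h ⟨(r, r⁻¹ * s), ⟨hr, h'⟩, by simp⟩
    rw [image_eq_zero_of_notMem_tsupport this, map_zero, mul_zero]
  · exact convIntegrand_eq_zero α f g hr

theorem isCompact_mulSupport (f g : C_c(G, A)) :
    IsCompact ((fun p : G × G => p.1 * p.2) '' (tsupport f ×ˢ tsupport g)) :=
  (f.hasCompactSupport.prod g.hasCompactSupport).image continuous_mul

/-- The twisted convolution product `(f * g)(s) = ∫ f(r) α_r(g(r⁻¹ s)) dr` on `C_c(G, A)`. -/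
noncomputable def conv (f g : C_c(G, A)) : C_c(G, A) where
  toFun s := vint 𝕜 μ fun r => f r * α.act r (g (r⁻¹ * s))
  continuous_toFun := by
    rw [← continuousOn_univ]
    exact continuousOn_vint 𝕜 f.hasCompactSupport (continuous_convIntegrand α f g)
      fun p x _ hx => convIntegrand_eq_zero α f g hx
  hasCompactSupport' := by
    refine HasCompactSupport.intro (isCompact_mulSupport f g) fun s hs => ?_
    simp only [convIntegrand_eq_zero' α f g hs]
    exact vint_zero 𝕜 μ

theorem conv_apply (f g : C_c(G, A)) (s : G) :
    conv μ α f g s = vint 𝕜 μ fun r => f r * α.act r (g (r⁻¹ * s)) := rfl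

theorem convIntegrand_slice (f g : C_c(G, A)) (s : G) :
    Continuous (fun r : G => f r * α.act r (g (r⁻¹ * s))) ∧
      HasCompactSupport (fun r : G => f r * α.act r (g (r⁻¹ * s))) :=
  ⟨(continuous_convIntegrand α f g).comp (by fun_prop : Continuous fun r : G => (s, r)),
    HasCompactSupport.intro f.hasCompactSupport fun _ hr => convIntegrand_eq_zero α f g hr⟩

theorem conv_add (f g h : C_c(G, A)) : conv μ α f (g + h) = conv μ α f g + conv μ α f h := by
  ext s
  simp only [conv_apply, CompactlySupportedContinuousMap.add_apply, map_add, mul_add]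
  have h1 := convIntegrand_slice α f g s
  have h2 := convIntegrand_slice α f h s
  exact vint_add 𝕜 h1.1 h1.2 h2.1 h2.2

theorem add_conv (f g h : C_c(G, A)) : conv μ α (f + g) h = conv μ α f h + conv μ α g h := by
  ext s
  simp only [conv_apply, CompactlySupportedContinuousMap.add_apply, add_mul]
  have h1 := convIntegrand_slice α f h s
  have h2 := convIntegrand_slice α g h s
  exact vint_add 𝕜 h1.1 h1.2 h2.1 h2.2

theorem smul_conv (c : 𝕜) (f g : C_c(G, A)) : conv μ α (c • f) g = c • conv μ α f g := by
  ext s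
  have h1 := convIntegrand_slice α f g s
  have := map_vint 𝕜 (μ := μ) (c • ContinuousLinearMap.id 𝕜 A) h1.1 h1.2
  simpa [conv_apply, smul_mul_assoc] using this.symm

theorem conv_smul (c : 𝕜) (f g : C_c(G, A)) : conv μ α f (c • g) = c • conv μ α f g := by
  ext s
  have h1 := convIntegrand_slice α f g s
  have := map_vint 𝕜 (μ := μ) (c • ContinuousLinearMap.id 𝕜 A) h1.1 h1.2
  simpa [conv_apply, mul_smul_comm] using this.symm

theorem zero_conv (f : C_c(G, A)) : conv μ α 0 f = 0 := by
  have := smul_conv μ α (0 : 𝕜) 0 f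
  rwa [zero_smul, zero_smul] at this

theorem conv_zero (f : C_c(G, A)) : conv μ α f 0 = 0 := by
  have := conv_smul μ α (0 : 𝕜) f 0
  rwa [zero_smul, zero_smul] at this

theorem conv_assoc (f g h : C_c(G, A)) :
    conv μ α (conv μ α f g) h = conv μ α f (conv μ α g h) := by
  ext s
  have e1 : ∀ t, conv μ α f g t * α.act t (h (t⁻¹ * s)) =
      vint 𝕜 μ fun r => f r * α.act r (g (r⁻¹ * t)) * α.act t (h (t⁻¹ * s)) := fun t => by
    have h1 := convIntegrand_slice α f g t
    exact map_vint 𝕜 (μ := μ)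
      ((ContinuousLinearMap.mul 𝕜 A).flip (α.act t (h (t⁻¹ * s)))) h1.1 h1.2
  have e2 : ∀ r, f r * α.act r (conv μ α g h (r⁻¹ * s)) =
      vint 𝕜 μ fun t => f r * α.act r (g (r⁻¹ * t)) * α.act t (h (t⁻¹ * s)) := fun r => by
    have h1 := convIntegrand_slice α g h (r⁻¹ * s)
    have := map_vint 𝕜 (μ := μ)
      ((ContinuousLinearMap.mul 𝕜 A (f r)).comp (α.act r)) h1.1 h1.2
    rw [← vint_mul_left 𝕜 μ _ r]
    refine this.trans ?_
    congr 1
    ext t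
    simp only [ContinuousLinearMap.comp_apply, ContinuousLinearMap.mul_apply', α.act_mul,
      α.act_act, mul_assoc, inv_mul_cancel_left, mul_inv_rev]
  rw [conv_apply, conv_apply]
  simp only [e1, e2]
  apply vint_swap
  · have c1 := continuous_convIntegrand α f g
    have c2 := α.continuous_joint.comp
      (f := fun p : G × G => (p.1, h (p.1⁻¹ * s))) (by fun_prop)
    exact c1.mul c2
  · refine HasCompactSupport.intro ((isCompact_mulSupport f g).prod f.hasCompactSupport) ?_
    rintro ⟨t, r⟩ hp
    simp only [Function.uncurry]
    rw [Set.mem_prod, not_and_or] at hp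
    rcases hp with hp | hp
    · rw [convIntegrand_eq_zero' α f g hp, zero_mul]
    · rw [convIntegrand_eq_zero α f g hp, zero_mul]

end Convolution

section IntegratedForm

variable {α : DynSys 𝕜 A G} {X : Type*} [NormedAddCommGroup X] [NormedSpace 𝕜 X] [CompleteSpace X]

theorem ContCovRep.continuous_joint (p : ContCovRep α X) :
    Continuous fun q : G × X => p.U q.1 q.2 :=
  CrossedProd.continuous_joint p.continuous_U

theorem ContCovRep.continuous_π (p : ContCovRep α X) : Continuous p.π := by
  obtain ⟨C, hC⟩ := p.bounded
  exact AddMonoidHomClass.continuous_of_bound p.π C hC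

theorem intIntegrand (p : ContCovRep α X) (f : C_c(G, A)) (x : X) :
    Continuous (fun s => p.π (f s) (p.U s x)) ∧
      HasCompactSupport (fun s => p.π (f s) (p.U s x)) := by
  refine ⟨(p.continuous_π.comp f.continuous).clm_apply (p.continuous_U x), ?_⟩
  refine HasCompactSupport.intro f.hasCompactSupport fun s hs => ?_
  simp [image_eq_zero_of_notMem_tsupport hs]

theorem norm_intForm_le (p : ContCovRep α X) (f : C_c(G, A)) {C M : ℝ} (hC0 : 0 ≤ C)
    (hC : ∀ a, ‖p.π a‖ ≤ C * ‖a‖) (hM : ∀ s ∈ tsupport f, ‖p.U s‖ ≤ M) (x : X) :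
    ‖vint 𝕜 μ fun s => p.π (f s) (p.U s x)‖ ≤ C * M * (∫ s, ‖f s‖ ∂μ) * ‖x‖ := by
  refine (norm_vint_le 𝕜 μ _).trans ?_
  rw [show C * M * (∫ s, ‖f s‖ ∂μ) * ‖x‖ = ∫ s, C * M * ‖x‖ * ‖f s‖ ∂μ by
    rw [integral_const_mul]; ring]
  have h1 := intIntegrand p f x
  refine integral_mono (h1.1.norm.integrable_of_hasCompactSupport h1.2.norm)
    ((f.continuous.norm.integrable_of_hasCompactSupport f.hasCompactSupport.norm).const_mul _)
    fun s => ?_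
  by_cases hs : s ∈ tsupport f
  · calc ‖p.π (f s) (p.U s x)‖ ≤ ‖p.π (f s)‖ * (‖p.U s‖ * ‖x‖) :=
          (p.π (f s)).le_opNorm_of_le ((p.U s).le_opNorm x)
      _ ≤ (C * ‖f s‖) * (M * ‖x‖) := by gcongr; exacts [hC _, hM s hs]
      _ = C * M * ‖x‖ * ‖f s‖ := by ring
  · simp [image_eq_zero_of_notMem_tsupport hs]

/-- The integrated form `π ⋊ U (f) = ∫ π(f(s)) U_s ds`, an operator defined pointwise on `X`. -/
noncomputable def intForm (p : ContCovRep α X) (f : C_c(G, A)) : X →L[𝕜] X :=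
  LinearMap.mkContinuousOfExistsBound
    { toFun := fun x => vint 𝕜 μ fun s => p.π (f s) (p.U s x)
      map_add' := fun x y => by
        have h1 := intIntegrand p f x
        have h2 := intIntegrand p f y
        simpa only [map_add] using vint_add 𝕜 (μ := μ) h1.1 h1.2 h2.1 h2.2
      map_smul' := fun c x => by
        have h1 := intIntegrand p f x
        have := map_vint 𝕜 (μ := μ) (c • ContinuousLinearMap.id 𝕜 X) h1.1 h1.2
        simpa using this.symm }
    (by
      obtain ⟨C, hC⟩ := p.bounded
      obtain ⟨M, hM0, hM⟩ := exists_bound_on_compact p.continuous_U f.hasCompactSupport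
      exact ⟨_, norm_intForm_le μ p f (le_max_right C 0)
        (fun a => (hC a).trans (by gcongr; exact le_max_left _ _)) hM⟩)

theorem intForm_apply (p : ContCovRep α X) (f : C_c(G, A)) (x : X) :
    intForm μ p f x = vint 𝕜 μ fun s => p.π (f s) (p.U s x) := rfl

theorem intForm_add (p : ContCovRep α X) (f g : C_c(G, A)) :
    intForm μ p (f + g) = intForm μ p f + intForm μ p g := by
  ext x
  have h1 := intIntegrand p f x
  have h2 := intIntegrand p g x
  simpa [intForm_apply] using vint_add 𝕜 (μ := μ) h1.1 h1.2 h2.1 h2.2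

theorem intForm_smul (p : ContCovRep α X) (c : 𝕜) (f : C_c(G, A)) :
    intForm μ p (c • f) = c • intForm μ p f := by
  ext x
  have h1 := intIntegrand p f x
  have := map_vint 𝕜 (μ := μ) (c • ContinuousLinearMap.id 𝕜 X) h1.1 h1.2
  simpa [intForm_apply] using this.symm

theorem intForm_conv (p : ContCovRep α X) (f g : C_c(G, A)) :
    intForm μ p (conv μ α f g) = intForm μ p f * intForm μ p g := by
  ext x
  let πL : A →L[𝕜] (X →L[𝕜] X) := ⟨(p.π : A →ₗ[𝕜] (X →L[𝕜] X)), p.continuous_π⟩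
  have e1 : ∀ s, p.π (conv μ α f g s) (p.U s x) =
      vint 𝕜 μ fun r => p.π (f r * α.act r (g (r⁻¹ * s))) (p.U s x) := fun s => by
    have h1 := convIntegrand_slice α f g s
    exact map_vint 𝕜 (μ := μ)
      ((ContinuousLinearMap.apply 𝕜 X (p.U s x)).comp πL) h1.1 h1.2
  have e2 : ∀ r, p.π (f r) (p.U r (intForm μ p g x)) =
      vint 𝕜 μ fun s => p.π (f r * α.act r (g (r⁻¹ * s))) (p.U s x) := fun r => by
    have h1 := intIntegrand p g x
    have := map_vint 𝕜 (μ := μ) ((p.π (f r)).comp (p.U r)) h1.1 h1.2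
    rw [← vint_mul_left 𝕜 μ _ r]
    refine this.trans ?_
    congr 1
    ext t
    have h2 : p.U r⁻¹ (p.U r (p.U t x)) = p.U t x := by
      change (p.U r⁻¹ * p.U r) (p.U t x) = _
      rw [← map_mul]; simp
    simp [p.covariant, h2]
  change intForm μ p (conv μ α f g) x = intForm μ p f (intForm μ p g x)
  rw [intForm_apply, intForm_apply μ p f]
  simp only [e1, e2]
  apply vint_swap
  · exact (p.continuous_π.comp (continuous_convIntegrand α f g)).clm_apply
      ((p.continuous_U x).comp continuous_fst)
  · refine HasCompactSupport.intro ((isCompact_mulSupport f g).prod f.hasCompactSupport) ?_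
    rintro ⟨t, r⟩ hp
    simp only [Function.uncurry]
    rw [Set.mem_prod, not_and_or] at hp
    rcases hp with hp | hp
    · rw [convIntegrand_eq_zero' α f g hp, map_zero]; rfl
    · rw [convIntegrand_eq_zero α f g hp, map_zero]; rfl

end IntegratedForm

section Involution

variable (α : DynSys 𝕜 A G)

/-- The modular function, normalised by `Δ(r) ∫ f(s r) ds = ∫ f(s) ds`. -/
noncomputable def modular (r : G) : ℝ := (Measure.modularCharacterFun r⁻¹ : ℝ)

theorem integral_mul_right_eq {f : G → ℝ} (hf : Continuous f) (hf' : HasCompactSupport f) (r : G) :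
    ∫ s, f (s * r) ∂μ = modular r⁻¹ * ∫ s, f s ∂μ := by
  have h1 := Measure.integral_isMulLeftInvariant_eq_smul_of_hasCompactSupport
    (Measure.map (· * r) μ) μ hf hf'
  rw [← Measure.modularCharacterFun_eq_haarScalarFactor, integral_smul_nnreal_measure,
    integral_map (by fun_prop) hf.aestronglyMeasurable] at h1
  rw [h1, modular, inv_inv]
  rfl

theorem modular_mul_integral {f : G → ℝ} (hf : Continuous f) (hf' : HasCompactSupport f) (r : G) :
    modular r * ∫ s, f (s * r) ∂μ = ∫ s, f s ∂μ := by
  have h1 := Measure.modularCharacterFun_map_mul r⁻¹ r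
  rw [inv_mul_cancel, Measure.modularCharacterFun_map_one] at h1
  rw [integral_mul_right_eq μ hf hf', modular, modular, inv_inv, ← mul_assoc, ← NNReal.coe_mul,
    ← h1, NNReal.coe_one, one_mul]

theorem continuous_modular : Continuous (modular : G → ℝ) := by
  let ν : Measure G := Measure.haar
  obtain ⟨⟨g, g_cont⟩, g_comp, g_nonneg, g_one⟩ :
    ∃ g : C(G, ℝ), HasCompactSupport g ∧ 0 ≤ g ∧ g 1 ≠ 0 := exists_continuous_nonneg_pos 1
  have hpos : 0 < ∫ x, g x ∂ν :=
    g_cont.integral_pos_of_hasCompactSupport_nonneg_nonzero g_comp g_nonneg g_one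
  have h1 : ∀ x, ∫ y, g (y⁻¹ * x) ∂ν.inv = modular x⁻¹ * ∫ s, g s ∂ν := fun x => by
    rw [← integral_mul_right_eq ν g_cont g_comp, Measure.inv, integral_map]
    · simp
    · fun_prop
    · exact (by fun_prop : Continuous fun y => g (y⁻¹ * x)).aestronglyMeasurable
  have h2 : Continuous fun x : G => modular x⁻¹ := by
    have h3 := (continuous_integral_apply_inv_mul (μ := ν.inv) g_cont g_comp).div_const
      (∫ s, g s ∂ν)
    refine h3.congr fun x => ?_
    rw [h1, mul_div_cancel_right₀ _ hpos.ne']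
  refine (h2.comp continuous_inv).congr fun x => ?_
  simp

theorem integral_modular_inv {f : G → ℝ} (hf : Continuous f) (hf' : HasCompactSupport f) :
    ∫ s, modular s⁻¹ * f s⁻¹ ∂μ = ∫ s, f s ∂μ := by
  obtain ⟨⟨g, g_cont⟩, g_comp, g_nonneg, g_one⟩ :
    ∃ g : C(G, ℝ), HasCompactSupport g ∧ 0 ≤ g ∧ g 1 ≠ 0 := exists_continuous_nonneg_pos 1
  have hpos : 0 < ∫ x, g x ∂μ :=
    g_cont.integral_pos_of_hasCompactSupport_nonneg_nonzero g_comp g_nonneg g_one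
  have h1 : ∀ x, ∫ y, g (y⁻¹ * x) ∂μ.inv = modular x⁻¹ * ∫ s, g s ∂μ := fun x => by
    rw [← integral_mul_right_eq μ g_cont g_comp, Measure.inv, integral_map]
    · simp
    · fun_prop
    · exact (by fun_prop : Continuous fun y => g (y⁻¹ * x)).aestronglyMeasurable
  have hm : ∀ x : G, modular x⁻¹ * modular x = 1 := fun x => by
    have h1 := Measure.modularCharacterFun_map_mul x x⁻¹
    rw [mul_inv_cancel, Measure.modularCharacterFun_map_one] at h1
    rw [modular, modular, inv_inv, ← NNReal.coe_mul, ← h1, NNReal.coe_one]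
  have h2 := Measure.integral_isMulLeftInvariant_isMulRightInvariant_combo (μ := μ) (ν := μ.inv)
    hf hf' g_cont g_comp g_nonneg g_one
  simp only [h1] at h2
  rw [h2, Measure.inv, integral_map, ← integral_mul_const]
  · congr 1
    ext s
    have h3 := hm s
    have h4 : modular s ≠ 0 := right_ne_zero_of_mul (by rw [h3]; exact one_ne_zero)
    rw [inv_inv]
    field_simp
    rw [mul_right_comm, h3, one_mul]
  · fun_prop
  · refine Continuous.aestronglyMeasurable (hf.mul (Continuous.inv₀ ?_ ?_))
    · exact (continuous_modular.comp continuous_inv).mul continuous_const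
    · exact fun x => mul_ne_zero (left_ne_zero_of_mul (by rw [hm]; exact one_ne_zero)) hpos.ne'

theorem vint_modular_inv {f : G → 𝕜} (hf : Continuous f) (hf' : HasCompactSupport f) :
    vint 𝕜 μ (fun s => (modular s⁻¹ : 𝕜) * f s⁻¹) = vint 𝕜 μ f := by
  have key : ∀ L : 𝕜 →L[ℝ] ℝ, L (vint 𝕜 μ (fun s => (modular s⁻¹ : 𝕜) * f s⁻¹))
      = L (vint 𝕜 μ f) := fun L => by
    have hc : Continuous fun s : G => (modular s⁻¹ : 𝕜) * f s⁻¹ :=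
      (RCLike.continuous_ofReal.comp (continuous_modular.comp continuous_inv)).mul
        (hf.comp continuous_inv)
    have hc' : HasCompactSupport fun s : G => (modular s⁻¹ : 𝕜) * f s⁻¹ :=
      (hf'.comp_homeomorph (Homeomorph.inv G)).mul_left
    have e1 := L.integral_comp_comm (hc.integrable_of_hasCompactSupport (μ := μ) hc')
    have e2 := L.integral_comp_comm (hf.integrable_of_hasCompactSupport (μ := μ) hf')
    have e3 := integral_modular_inv μ (L.continuous.comp hf) (hf'.comp_left (map_zero L))
    rw [vint_eq_integral, vint_eq_integral]
    refine e1.symm.trans (Eq.trans ?_ e2)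
    rw [← Function.comp_def L f, ← e3]
    congr 1
    ext s
    rw [← RCLike.real_smul_eq_coe_mul, map_smul]
    rfl
  exact RCLike.ext (key RCLike.reCLM) (key RCLike.imCLM)

variable [StarRing A] [StarModule 𝕜 A] [ContinuousStar A]

/-- The involution `f^*(s) = Δ(s⁻¹) α_s(f(s⁻¹)^*)` on `C_c(G, A)`. -/
noncomputable def ccStar (f : C_c(G, A)) : C_c(G, A) where
  toFun s := (modular s⁻¹ : 𝕜) • α.act s (star (f s⁻¹))
  continuous_toFun := by
    refine (RCLike.continuous_ofReal.comp (continuous_modular.comp continuous_inv)).smul ?_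
    exact α.continuous_joint.comp (f := fun s : G => (s, star (f s⁻¹))) (by fun_prop)
  hasCompactSupport' := by
    have h := f.hasCompactSupport.comp_homeomorph (Homeomorph.inv G)
    refine HasCompactSupport.intro h fun s hs => ?_
    have : f s⁻¹ = 0 := image_eq_zero_of_notMem_tsupport (f := f ∘ Homeomorph.inv G) hs
    simp [this]

theorem ccStar_sub (f g : C_c(G, A)) : ccStar α (f - g) = ccStar α f - ccStar α g := by
  ext s
  simp [ccStar, smul_sub]

end Involution

section Involutive

variable [StarRing A] {α : DynSys 𝕜 A G} {X : Type*} [NormedAddCommGroup X] [i : NormedSpace 𝕜 X]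

/-- The system is involutive: every `α s` is a `*`-automorphism of `A`. -/
def DynSys.IsInvolutive (α : DynSys 𝕜 A G) : Prop :=
  ∀ s a, α.act s (star a) = star (α.act s a)

/-- `(π, U)` is an involutive covariant representation: the space `X` is a Hilbert space (its norm
comes from a, necessarily unique, inner product), `π(a^*) = π(a)^*`, and each `U s` is unitary. -/
def CovRep.IsInvolutive (p : CovRep α X) : Prop :=
  ∃ h : InnerProductSpace 𝕜 X, h.toNormedSpace = i ∧
    (∀ a x y, h.inner (p.π (star a) x) y = h.inner x (p.π a y)) ∧
    ∀ s x y, h.inner (p.U s x) (p.U s y) = h.inner x y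

end Involutive

/-- A bundled Banach space over `𝕜`. -/
structure BanachSp (𝕜 : Type v) [RCLike 𝕜] where
  carrier : Type w
  [group : NormedAddCommGroup carrier]
  [space : NormedSpace 𝕜 carrier]
  [complete : CompleteSpace carrier]

instance : CoeSort (BanachSp 𝕜) (Type _) := ⟨BanachSp.carrier⟩

attribute [instance] BanachSp.group BanachSp.space BanachSp.complete

/-- A non-empty uniformly bounded class `R` of continuous covariant representations on Banach
spaces. -/
structure UBClass (α : DynSys 𝕜 A G) where
  carrier : Set (Σ X : BanachSp.{v, w} 𝕜, ContCovRep α X)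
  nonempty : carrier.Nonempty
  bounded : ∃ C : ℝ, 0 ≤ C ∧ ∃ ν : G → ℝ, (∀ r, 0 ≤ ν r) ∧
    (∀ K : Set G, IsCompact K → BddAbove (ν '' K)) ∧
    ∀ p ∈ carrier, (∀ a, ‖p.2.π a‖ ≤ C * ‖a‖) ∧ ∀ r, ‖p.2.U r‖ ≤ ν r

section Seminorm

variable {α : DynSys 𝕜 A G} (R : UBClass α)

/-- The seminorm `σ^R(f) = sup_{(π, U) ∈ R} ‖π ⋊ U (f)‖` on `C_c(G, A)`. -/
noncomputable def sigma (f : C_c(G, A)) : ℝ := ⨆ p : R.carrier, ‖intForm μ p.1.2 f‖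

theorem sigma_bddAbove (f : C_c(G, A)) :
    BddAbove (Set.range fun p : R.carrier => ‖intForm μ p.1.2 f‖) := by
  obtain ⟨C, hC0, ν, hν0, hν, h⟩ := R.bounded
  obtain ⟨M, hM⟩ := hν _ f.hasCompactSupport
  refine ⟨C * max M 0 * ∫ s, ‖f s‖ ∂μ, ?_⟩
  rintro _ ⟨p, rfl⟩
  refine ContinuousLinearMap.opNorm_le_bound _ (by positivity) fun x => ?_
  exact norm_intForm_le μ p.1.2 f hC0 (h p.1 p.2).1
    (fun s hs => ((h p.1 p.2).2 s).trans ((hM ⟨s, hs, rfl⟩).trans (le_max_left _ _))) x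

theorem norm_intForm_le_sigma (f : C_c(G, A)) {p : Σ X : BanachSp.{v, w} 𝕜, ContCovRep α X}
    (hp : p ∈ R.carrier) : ‖intForm μ p.2 f‖ ≤ sigma μ R f :=
  le_ciSup (sigma_bddAbove μ R f) ⟨p, hp⟩

theorem sigma_nonneg (f : C_c(G, A)) : 0 ≤ sigma μ R f :=
  Real.iSup_nonneg fun _ => norm_nonneg _

theorem sigma_le {f : C_c(G, A)} {c : ℝ} (h : ∀ p ∈ R.carrier, ‖intForm μ p.2 f‖ ≤ c) :
    sigma μ R f ≤ c :=
  have : Nonempty R.carrier := R.nonempty.to_subtype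
  ciSup_le fun p => h p.1 p.2

theorem sigma_add_le (f g : C_c(G, A)) : sigma μ R (f + g) ≤ sigma μ R f + sigma μ R g := by
  refine sigma_le μ R fun p hp => ?_
  rw [intForm_add]
  exact (norm_add_le _ _).trans
    (add_le_add (norm_intForm_le_sigma μ R f hp) (norm_intForm_le_sigma μ R g hp))

theorem sigma_smul_le (c : 𝕜) (f : C_c(G, A)) : sigma μ R (c • f) ≤ ‖c‖ * sigma μ R f := by
  refine sigma_le μ R fun p hp => ?_
  rw [intForm_smul, norm_smul]
  gcongr
  exact norm_intForm_le_sigma μ R f hp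

theorem sigma_zero : sigma μ R 0 = 0 := by
  have := sigma_smul_le μ R (0 : 𝕜) 0
  rw [zero_smul, norm_zero, zero_mul] at this
  exact le_antisymm this (sigma_nonneg μ R 0)

theorem sigma_neg (f : C_c(G, A)) : sigma μ R (-f) = sigma μ R f := by
  have h : ∀ g : C_c(G, A), sigma μ R (-g) ≤ sigma μ R g := fun g => by
    have := sigma_smul_le μ R (-1 : 𝕜) g
    rwa [neg_one_smul, norm_neg, norm_one, one_mul] at this
  refine le_antisymm (h f) ?_
  have := h (-f)
  rwa [neg_neg] at this

theorem sigma_conv_le (f g : C_c(G, A)) :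
    sigma μ R (conv μ α f g) ≤ sigma μ R f * sigma μ R g := by
  refine sigma_le μ R fun p hp => ?_
  rw [intForm_conv]
  exact (norm_mul_le _ _).trans (mul_le_mul (norm_intForm_le_sigma μ R f hp)
    (norm_intForm_le_sigma μ R g hp) (norm_nonneg _) (sigma_nonneg μ R f))

/-- The algebra `C_c(G, A)` with the twisted convolution product and the seminorm `σ^R`. -/
def CcAlg (_μ : Measure G) (_R : UBClass α) := C_c(G, A)

instance : AddCommGroup (CcAlg μ R) := inferInstanceAs (AddCommGroup C_c(G, A))

instance : Module 𝕜 (CcAlg μ R) := inferInstanceAs (Module 𝕜 C_c(G, A))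

noncomputable instance : NonUnitalRing (CcAlg μ R) :=
  { (inferInstance : AddCommGroup (CcAlg μ R)) with
    mul := conv μ α
    left_distrib := conv_add μ α
    right_distrib := add_conv μ α
    zero_mul := zero_conv μ α
    mul_zero := conv_zero μ α
    mul_assoc := conv_assoc μ α }

instance : IsScalarTower 𝕜 (CcAlg μ R) (CcAlg μ R) := ⟨fun c f g => smul_conv μ α c f g⟩

instance : SMulCommClass 𝕜 (CcAlg μ R) (CcAlg μ R) := ⟨fun c f g => (conv_smul μ α c f g).symm⟩

noncomputable instance : SeminormedAddCommGroup (CcAlg μ R) :=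
  AddGroupSeminorm.toSeminormedAddCommGroup
    { toFun := sigma μ R
      map_zero' := sigma_zero μ R
      add_le' := sigma_add_le μ R
      neg' := sigma_neg μ R }

theorem CcAlg.norm_def (f : CcAlg μ R) : ‖f‖ = sigma μ R f := rfl

noncomputable instance : NonUnitalSeminormedRing (CcAlg μ R) :=
  { (inferInstance : NonUnitalRing (CcAlg μ R)),
    (inferInstance : SeminormedAddCommGroup (CcAlg μ R)) with
    norm_mul_le := sigma_conv_le μ R }

noncomputable instance : NormedSpace 𝕜 (CcAlg μ R) where
  norm_smul_le := sigma_smul_le μ R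

end Seminorm

section CrossedProduct

open UniformSpace

variable {α : DynSys 𝕜 A G} (R : UBClass α)

/-- The crossed product `(A ⋊_α G)^R`: the (Hausdorff) completion of `C_c(G, A)` for `σ^R`. -/
def CrossedProduct := Completion (CcAlg μ R)

noncomputable instance : NormedAddCommGroup (CrossedProduct μ R) :=
  inferInstanceAs (NormedAddCommGroup (Completion (CcAlg μ R)))

noncomputable instance : NormedSpace 𝕜 (CrossedProduct μ R) :=
  inferInstanceAs (NormedSpace 𝕜 (Completion (CcAlg μ R)))

instance : CompleteSpace (CrossedProduct μ R) :=
  inferInstanceAs (CompleteSpace (Completion (CcAlg μ R)))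

/-- The canonical map `q^R : C_c(G, A) → (A ⋊_α G)^R`. -/
noncomputable def quot : CcAlg μ R →L[𝕜] CrossedProduct μ R :=
  Completion.toComplL (𝕜 := 𝕜) (E := CcAlg μ R)

theorem norm_quot (f : CcAlg μ R) : ‖quot μ R f‖ = sigma μ R f :=
  Completion.norm_coe (E := CcAlg μ R) f

theorem isDenseInducing_quot : IsDenseInducing (quot μ R) :=
  Completion.isDenseInducing_coe (α := CcAlg μ R)

theorem denseRange_quot : DenseRange (quot μ R) := (isDenseInducing_quot μ R).dense

/-- Multiplication on the crossed product: the continuous extension of twisted convolution. -/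
noncomputable instance : Mul (CrossedProduct μ R) :=
  ⟨fun x y => ((isDenseInducing_quot μ R).prodMap (isDenseInducing_quot μ R)).extend
    (fun p : CcAlg μ R × CcAlg μ R => quot μ R (p.1 * p.2)) (x, y)⟩

theorem quot_mul (f g : CcAlg μ R) : quot μ R (f * g) = quot μ R f * quot μ R g :=
  (((isDenseInducing_quot μ R).prodMap (isDenseInducing_quot μ R)).extend_eq
    (f := fun p : CcAlg μ R × CcAlg μ R => quot μ R (p.1 * p.2))
    ((quot μ R).continuous.comp continuous_mul) (f, g)).symm

instance : ContinuousMul (CrossedProduct μ R) where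
  continuous_mul := by
    let q : CcAlg μ R →+ CrossedProduct μ R := (quot μ R : CcAlg μ R →+ CrossedProduct μ R)
    let m := (AddMonoidHom.mul : CcAlg μ R →+ CcAlg μ R →+ CcAlg μ R).compr₂ q
    have h : Continuous fun p : CcAlg μ R × CcAlg μ R => m p.1 p.2 :=
      (quot μ R).continuous.comp continuous_mul
    have di : IsDenseInducing q := isDenseInducing_quot μ R
    exact di.extend_Z_bilin di h

noncomputable instance : NonUnitalRing (CrossedProduct μ R) :=
  { (inferInstance : AddCommGroup (CrossedProduct μ R)),
    (inferInstance : Mul (CrossedProduct μ R)) with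
    zero_mul := fun a => (denseRange_quot μ R).induction_on a
      (isClosed_eq (by fun_prop) (by fun_prop))
      fun f => by rw [← map_zero (quot μ R), ← quot_mul, zero_mul]
    mul_zero := fun a => (denseRange_quot μ R).induction_on a
      (isClosed_eq (by fun_prop) (by fun_prop))
      fun f => by rw [← map_zero (quot μ R), ← quot_mul, mul_zero]
    mul_assoc := fun a b c => (denseRange_quot μ R).induction_on₃
      (isClosed_eq (by fun_prop) (by fun_prop))
      (fun f g h => by simp only [← quot_mul, mul_assoc]) a b c
    left_distrib := fun a b c => (denseRange_quot μ R).induction_on₃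
      (isClosed_eq (by fun_prop) (by fun_prop))
      (fun f g h => by simp only [← quot_mul, ← map_add, mul_add]) a b c
    right_distrib := fun a b c => (denseRange_quot μ R).induction_on₃
      (isClosed_eq (by fun_prop) (by fun_prop))
      (fun f g h => by simp only [← quot_mul, ← map_add, add_mul]) a b c }

noncomputable instance : NonUnitalNormedRing (CrossedProduct μ R) :=
  { (inferInstance : NonUnitalRing (CrossedProduct μ R)),
    (inferInstance : NormedAddCommGroup (CrossedProduct μ R)) with
    norm_mul_le := fun a b => (denseRange_quot μ R).induction_on₂
      (isClosed_le (by fun_prop) (by fun_prop))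
      (fun f g => by
        rw [← quot_mul, norm_quot, norm_quot, norm_quot]; exact sigma_conv_le μ R f g) a b }

theorem cp_smul_mul (c : 𝕜) (a b : CrossedProduct μ R) : c • a * b = c • (a * b) :=
  (denseRange_quot μ R).induction_on₂ (p := fun a b => c • a * b = c • (a * b))
    (isClosed_eq ((continuous_fst.const_smul c).mul continuous_snd)
      ((continuous_fst.mul continuous_snd).const_smul c))
    (fun f g => by rw [← map_smul, ← quot_mul, ← quot_mul, ← map_smul, smul_mul_assoc]) a b

theorem cp_mul_smul (c : 𝕜) (a b : CrossedProduct μ R) : a * c • b = c • (a * b) :=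
  (denseRange_quot μ R).induction_on₂ (p := fun a b => a * c • b = c • (a * b))
    (isClosed_eq (continuous_fst.mul (continuous_snd.const_smul c))
      ((continuous_fst.mul continuous_snd).const_smul c))
    (fun f g => by rw [← map_smul, ← quot_mul, ← quot_mul, ← map_smul, mul_smul_comm]) a b

instance : IsScalarTower 𝕜 (CrossedProduct μ R) (CrossedProduct μ R) := ⟨cp_smul_mul μ R⟩

instance : SMulCommClass 𝕜 (CrossedProduct μ R) (CrossedProduct μ R) :=
  ⟨fun c a b => (cp_mul_smul μ R c a b).symm⟩

section IntRep

variable {R} {X : Type*} [NormedAddCommGroup X] [NormedSpace 𝕜 X] [CompleteSpace X]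

variable (R) in
/-- `(π, U)` is `R`-continuous: its integrated form is bounded with respect to `σ^R`. -/
def IsRCont (p : ContCovRep α X) : Prop :=
  ∃ C : ℝ, ∀ f : C_c(G, A), ‖intForm μ p f‖ ≤ C * sigma μ R f

theorem isRCont_of_mem {p : Σ X : BanachSp.{v, w} 𝕜, ContCovRep α X} (hp : p ∈ R.carrier) :
    IsRCont μ R p.2 :=
  ⟨1, fun f => by rw [one_mul]; exact norm_intForm_le_sigma μ R f hp⟩

/-- The integrated form of an `R`-continuous representation as a bounded operator on
`(C_c(G, A), σ^R)`. -/
noncomputable def intFormL {p : ContCovRep α X} (hp : IsRCont μ R p) :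
    CcAlg μ R →L[𝕜] (X →L[𝕜] X) :=
  LinearMap.mkContinuousOfExistsBound
    { toFun := fun f => intForm μ p f
      map_add' := intForm_add μ p
      map_smul' := intForm_smul μ p } hp

theorem isUniformInducing_quot : IsUniformInducing (quot μ R) :=
  Completion.isUniformInducing_coe (CcAlg μ R)

/-- The continuous extension of the integrated form to the crossed product. -/
noncomputable def intRepL {p : ContCovRep α X} (hp : IsRCont μ R p) :
    CrossedProduct μ R →L[𝕜] (X →L[𝕜] X) :=
  (intFormL μ hp).extend (quot μ R)

theorem intRepL_quot {p : ContCovRep α X} (hp : IsRCont μ R p) (f : CcAlg μ R) :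
    intRepL μ hp (quot μ R f) = intForm μ p f :=
  ContinuousLinearMap.extend_eq (intFormL μ hp) (denseRange_quot μ R) (isUniformInducing_quot μ) f

theorem intRepL_mul {p : ContCovRep α X} (hp : IsRCont μ R p) (a b : CrossedProduct μ R) :
    intRepL μ hp (a * b) = intRepL μ hp a * intRepL μ hp b :=
  (denseRange_quot μ R).induction_on₂
    (p := fun a b => intRepL μ hp (a * b) = intRepL μ hp a * intRepL μ hp b)
    (isClosed_eq ((intRepL μ hp).continuous.comp continuous_mul)
      (((intRepL μ hp).continuous.comp continuous_fst).mul
        ((intRepL μ hp).continuous.comp continuous_snd)))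
    (fun f g => by
      rw [← quot_mul, intRepL_quot, intRepL_quot, intRepL_quot]
      exact intForm_conv μ p f g) a b

/-- The representation `(π ⋊ U)^R` of the crossed product, determined by
`(π ⋊ U)^R (q^R f) = π ⋊ U (f)` and continuity. -/
noncomputable def intRep {p : ContCovRep α X} (hp : IsRCont μ R p) :
    CrossedProduct μ R →ₙₐ[𝕜] (X →L[𝕜] X) where
  toFun := intRepL μ hp
  map_smul' := map_smul (intRepL μ hp)
  map_zero' := map_zero (intRepL μ hp)
  map_add' := map_add (intRepL μ hp)
  map_mul' := intRepL_mul μ hp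

theorem continuous_intRep {p : ContCovRep α X} (hp : IsRCont μ R p) :
    Continuous (intRep μ hp) := (intRepL μ hp).continuous

theorem intRep_quot {p : ContCovRep α X} (hp : IsRCont μ R p) (f : CcAlg μ R) :
    intRep μ hp (quot μ R f) = intForm μ p f := intRepL_quot μ hp f

end IntRep

section Star

variable [StarRing A] [StarModule 𝕜 A] [ContinuousStar A]

/-- The involution on the crossed product: the continuous extension of the involution of
`C_c(G, A)`. (If the class `R` is involutive, then the latter is bounded with respect to
`σ^R`, see below, so that the extension exists.) -/
noncomputable def cpStar : CrossedProduct μ R → CrossedProduct μ R :=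
  Completion.map (α := CcAlg μ R) (β := CcAlg μ R) (ccStar α)

theorem inner_ccStar {α : DynSys 𝕜 A G} {X : Type*} [NormedAddCommGroup X]
    [i : NormedSpace 𝕜 X] [CompleteSpace X] (p : ContCovRep α X) (h : InnerProductSpace 𝕜 X)
    (hi : h.toNormedSpace = i)
    (hπ : ∀ a x y, h.inner (p.π (star a) x) y = h.inner x (p.π a y))
    (hU : ∀ s x y, h.inner (p.U s x) (p.U s y) = h.inner x y) (f : C_c(G, A)) (x y : X) :
    h.inner (intForm μ p (ccStar α f) x) y = h.inner x (intForm μ p f y) := by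
  subst hi
  have e1 := map_vint 𝕜 (μ := μ) (innerSL 𝕜 y) (intIntegrand p (ccStar α f) x).1
    (intIntegrand p (ccStar α f) x).2
  have e2 := map_vint 𝕜 (μ := μ) (innerSL 𝕜 x) (intIntegrand p f y).1 (intIntegrand p f y).2
  have hc : Continuous fun s => innerSL 𝕜 x (p.π (f s) (p.U s y)) :=
    (innerSL 𝕜 x).continuous.comp (intIntegrand p f y).1
  have hc' : HasCompactSupport fun s => innerSL 𝕜 x (p.π (f s) (p.U s y)) :=
    (intIntegrand p f y).2.comp_left (map_zero (innerSL 𝕜 x))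
  have e3 := vint_modular_inv μ hc hc'
  have hUU : ∀ s z, p.U s (p.U s⁻¹ z) = z := fun s z => by
    change (p.U s * p.U s⁻¹) z = z
    rw [← map_mul]; simp
  have key : ∀ s, inner 𝕜 (p.π (ccStar α f s) (p.U s x)) y =
      (modular s⁻¹ : 𝕜) * inner 𝕜 x (p.π (f s⁻¹) (p.U s⁻¹ y)) := fun s => by
    have h1 : p.π (ccStar α f s) (p.U s x) =
        (modular s⁻¹ : 𝕜) • p.U s (p.π (star (f s⁻¹)) x) := by
      change p.π ((modular s⁻¹ : 𝕜) • α.act s (star (f s⁻¹))) (p.U s x) = _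
      have h2 : p.U s⁻¹ (p.U s x) = x := by simpa using hUU s⁻¹ x
      simp [p.covariant, h2]
    rw [h1, inner_smul_left, RCLike.conj_ofReal]
    congr 1
    have h2 := hU s (p.π (star (f s⁻¹)) x) (p.U s⁻¹ y)
    rw [hUU] at h2
    exact h2.trans (hπ _ _ _)
  have hint : inner 𝕜 y (intForm μ p (ccStar α f) x) =
      vint 𝕜 μ fun s => inner 𝕜 y (p.π (ccStar α f s) (p.U s x)) := e1
  change inner 𝕜 (intForm μ p (ccStar α f) x) y = inner 𝕜 x (intForm μ p f y)
  rw [← inner_conj_symm, hint, vint_eq_integral, ← integral_conj]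
  simp only [inner_conj_symm, key]
  rw [← vint_eq_integral 𝕜]
  exact e3.trans e2.symm

/-- `R` is involutive: every `(π, U)` in `R` is involutive. -/
def UBClass.IsInvolutive (R : UBClass α) : Prop := ∀ p ∈ R.carrier, p.2.toCovRep.IsInvolutive

theorem sigma_ccStar_le (hR : R.IsInvolutive) (f : C_c(G, A)) :
    sigma μ R (ccStar α f) ≤ sigma μ R f := by
  refine sigma_le μ R fun p hp => ?_
  obtain ⟨h, hi, hπ, hU⟩ := hR p hp
  refine (ContinuousLinearMap.opNorm_le_bound _ (norm_nonneg _) fun x => ?_).trans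
    (norm_intForm_le_sigma μ R f hp)
  have h1 := inner_ccStar μ p.2 h hi hπ hU f x (intForm μ p.2 (ccStar α f) x)
  set z := intForm μ p.2 (ccStar α f) x with hz
  have h2 : ‖z‖ * ‖z‖ ≤ ‖x‖ * (‖intForm μ p.2 f‖ * ‖z‖) := by
    have h3 : ‖h.inner z z‖ = ‖z‖ * ‖z‖ := by
      have := inner_self_eq_norm_mul_norm (𝕜 := 𝕜) z
      rw [← this]
      exact (congrArg norm (inner_self_ofReal_re (𝕜 := 𝕜) z)).symm.trans
        (by rw [RCLike.norm_ofReal, abs_of_nonneg inner_self_nonneg])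
    rw [← h3, h1]
    refine (norm_inner_le_norm (𝕜 := 𝕜) x _).trans ?_
    gcongr
    exact (intForm μ p.2 f).le_opNorm z
  rcases (norm_nonneg z).eq_or_lt with h0 | h0
  · rw [← h0]; positivity
  · refine le_of_mul_le_mul_right ?_ h0
    linarith

theorem cpStar_quot (hR : R.IsInvolutive) (f : C_c(G, A)) :
    cpStar μ R (quot μ R f) = quot μ R (ccStar α f) := by
  have h : LipschitzWith (α := CcAlg μ R) (β := CcAlg μ R) 1 (ccStar α) := by
    refine LipschitzWith.of_dist_le_mul fun a b => ?_
    have h1 := sigma_ccStar_le μ R hR (a - b)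
    have h2 : dist a b = sigma μ R (a - b) := dist_eq_norm a b
    rw [NNReal.coe_one, one_mul, h2]
    refine le_trans (le_of_eq ?_) h1
    rw [show ccStar α (a - b) = ccStar α a - ccStar α b from ccStar_sub α a b]
    exact dist_eq_norm (E := CcAlg μ R) _ _
  exact Completion.map_coe (α := CcAlg μ R) (β := CcAlg μ R) h.uniformContinuous f

/-- `T` is an involutive representation of the crossed product: the representation space is a
Hilbert space and `T(b^*) = T(b)^*`. -/
def IsInvolutiveRep {X : Type*} [NormedAddCommGroup X] [i : NormedSpace 𝕜 X]
    (T : CrossedProduct μ R →ₙₐ[𝕜] (X →L[𝕜] X)) : Prop :=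
  ∃ h : InnerProductSpace 𝕜 X, h.toNormedSpace = i ∧
    ∀ b x y, h.inner (T (cpStar μ R b) x) y = h.inner x (T b y)

end Star

/-- The representations of the crossed product in Banach spaces. -/
abbrev CPRep := Σ X : BanachSp.{v, w} 𝕜, CrossedProduct μ R →ₙₐ[𝕜] (X →L[𝕜] X)

/-- The map `(π, U) ↦ (π ⋊ U)^R` on `R`. -/
noncomputable def integration (p : R.carrier) : CPRep.{v, w} μ R :=
  ⟨p.1.1, intRep μ (isRCont_of_mem μ p.2)⟩

end CrossedProduct

end Defs

section Notions

variable {𝕜 : Type v} [RCLike 𝕜] {ι : Type*}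
  {X : Type*} [NormedAddCommGroup X] [NormedSpace 𝕜 X]
  {Y : Type*} [NormedAddCommGroup Y] [NormedSpace 𝕜 Y]

/-- Non-degeneracy: the linear span of all `T b x` is dense. -/
def Nondeg (T : ι → (X →L[𝕜] X)) : Prop :=
  Dense (Submodule.span 𝕜 {y | ∃ b x, T b x = y} : Set X)

/-- The subspace `Z` is invariant under all `T b`. -/
def Invariant (T : ι → (X →L[𝕜] X)) (Z : Submodule 𝕜 X) : Prop := ∀ b, ∀ z ∈ Z, T b z ∈ Z

/-- The bounded operator `Φ` intertwines `T` and `S`. -/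
def Intertwines (T : ι → (X →L[𝕜] X)) (S : ι → (Y →L[𝕜] Y)) (Φ : X →L[𝕜] Y) : Prop :=
  ∀ b, (S b).comp Φ = Φ.comp (T b)

/-- `A` has an `M`-bounded approximate left identity. The net is given by its filter of tails,
which is a filter on `A`. -/
def HasApproxLeftId (A : Type*) [NonUnitalNormedRing A] (M : ℝ) : Prop :=
  ∃ l : Filter A, l.NeBot ∧ (∀ᶠ u in l, ‖u‖ ≤ M) ∧ ∀ a, Tendsto (fun u => u * a) l (𝓝 a)

variable {A : Type*} [NonUnitalNormedRing A] [NormedSpace 𝕜 A]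
  {G : Type*} [Group G] [TopologicalSpace G]

/-- The class of all non-degenerate continuous covariant representations `(π, U)` in spaces from
`𝒳` with `π` contractive and every `U r` isometric. -/
def isomSet (α : DynSys 𝕜 A G) (𝒳 : Set (BanachSp.{v, w} 𝕜)) :
    Set (Σ X : BanachSp.{v, w} 𝕜, ContCovRep α X) :=
  {p | p.1 ∈ 𝒳 ∧ Nondeg p.2.π ∧ (∀ a, ‖p.2.π a‖ ≤ ‖a‖) ∧ ∀ r, Isometry (p.2.U r)}

/-- `isomSet`, when non-empty, as a non-empty uniformly bounded class. -/
def isomClass (α : DynSys 𝕜 A G) (𝒳 : Set (BanachSp.{v, w} 𝕜)) (h : (isomSet α 𝒳).Nonempty) :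
    UBClass.{v, w} α where
  carrier := isomSet α 𝒳
  nonempty := h
  bounded := by
    refine ⟨1, zero_le_one, fun _ => 1, fun _ => zero_le_one, fun K _ => ⟨1, ?_⟩, fun p hp => ?_⟩
    · rintro _ ⟨_, _, rfl⟩
      exact le_rfl
    · refine ⟨fun a => by rw [one_mul]; exact hp.2.2.1 a, fun r => ?_⟩
      refine ContinuousLinearMap.opNorm_le_bound _ zero_le_one fun x => ?_
      rw [one_mul]
      exact ((AddMonoidHomClass.isometry_iff_norm (p.2.U r)).1 (hp.2.2.2 r) x).le

end Notions

end CrossedProd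

/-! A pair $(\pi,U)$ is recovered from its integrated form by $\pi\rtimes U(\varphi\otimes
a)\to\pi(a)$ strongly, as $\varphi\ge 0$ of integral one concentrates at the identity
(`tendsto_intForm_ccTensor`), and by the rule that translating $f$ multiplies $\pi\rtimes U(f)$ on
the left by $U_t$ (`intForm_ccTrans`). Injectivity and the statements on invariant subspaces and
intertwiners follow from these and density of $C_c(G,A)$.

For surjectivity, all members of $\mathcal R$ are contractive, so $f\mapsto af$ and translation by
$t$ extend to left multipliers of the crossed product with norms at most $\|a\|$ and $1$. They form
a continuous covariant representation `cpRep`, whose integrated form is left multiplication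
(`intForm_cpRep`). Consequently the elements $q^{\mathcal R}(\varphi\otimes u)$ form left
approximate identities with the same bounds $1+\varepsilon$ as those of $A$ (`hasApproxLeftId`).

Given a non-degenerate contractive $T$, a left multiplier $L$ acts on the space of $T$ by
$T(b)x\mapsto T(Lb)x$. On a vector $y=\sum T(b_i)x_i$ the image is $\lim T(Lu)y$, of norm at most
$\|L\|(1+\varepsilon)\|y\|$ for every $\varepsilon$, hence at most $\|L\|\|y\|$
(`Nondeg.exists_multiplier`). The sharp constant makes the new $\pi$ contractive and each $U_t$,
together with its inverse, contractive, so that $U_t$ is isometric and the pair lies in $\mathcal R$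
(`exists_covRep`). -/

namespace CrossedProd

/-! ### Non-degenerate representations and the action of left multipliers -/

section Operators

variable {𝕜 : Type*} [RCLike 𝕜] {X : Type*} [NormedAddCommGroup X] [NormedSpace 𝕜 X]
  {Y : Type*} [NormedAddCommGroup Y] [NormedSpace 𝕜 Y]

/-- Pointwise convergence of a bounded net of operators need only be verified on a set with
dense linear span. -/
theorem tendsto_of_dense_span {ι : Type*} {l : Filter ι} {Ψ : ι → X →L[𝕜] Y} {Φ : X →L[𝕜] Y}
    {M : ℝ} (hM : ∀ᶠ i in l, ‖Ψ i‖ ≤ M) {S : Set X} (hS : Dense (Submodule.span 𝕜 S : Set X))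
    (h : ∀ x ∈ S, Tendsto (fun i => Ψ i x) l (𝓝 (Φ x))) (x : X) :
    Tendsto (fun i => Ψ i x) l (𝓝 (Φ x)) := by
  have hV : ∀ y ∈ Submodule.span 𝕜 S, Tendsto (fun i => Ψ i y) l (𝓝 (Φ y)) := fun y hy => by
    induction hy using Submodule.span_induction with
    | mem y hy => exact h y hy
    | zero => simpa using tendsto_const_nhds
    | add y z _ _ hy hz => simpa using hy.add hz
    | smul c y _ hy => simpa using hy.const_smul c
  rw [Metric.tendsto_nhds]
  intro ε hε
  -- Replacing `x` by a vector `y` of the span costs at most $(M+\|\Phi\|)\|x-y\|$, which is kept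
  -- below $\varepsilon/2$.
  have hD : 0 < max M 0 + ‖Φ‖ + 1 := by positivity
  obtain ⟨y, hy, hxy⟩ := hS.exists_dist_lt x (show 0 < ε / 2 / (max M 0 + ‖Φ‖ + 1) by positivity)
  rw [lt_div_iff₀ hD] at hxy
  filter_upwards [hM, Metric.tendsto_nhds.1 (hV y hy) (ε / 2) (by positivity)] with i hi hi'
  rw [dist_eq_norm] at *
  calc ‖Ψ i x - Φ x‖ = ‖Ψ i (x - y) + (Ψ i y - Φ y) - Φ (x - y)‖ := by
        congr 1; simp only [map_sub]; abel
    _ ≤ ‖Ψ i (x - y)‖ + ‖Ψ i y - Φ y‖ + ‖Φ (x - y)‖ :=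
        (norm_sub_le _ _).trans (by gcongr; exact norm_add_le _ _)
    _ ≤ max M 0 * ‖x - y‖ + ‖Ψ i y - Φ y‖ + ‖Φ‖ * ‖x - y‖ := by
        gcongr
        · exact (Ψ i).le_of_opNorm_le (hi.trans (le_max_left _ _)) _
        · exact Φ.le_opNorm _
    _ < ε := by nlinarith [norm_nonneg (x - y)]

theorem Nondeg.ext {ι : Type*} {T : ι → (X →L[𝕜] X)} (hT : Nondeg T) {P Q : X →L[𝕜] Y}
    (h : ∀ b x, P (T b x) = Q (T b x)) : P = Q := by
  refine ContinuousLinearMap.ext_on hT ?_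
  rintro _ ⟨b, x, rfl⟩
  exact h b x

/-- A non-degenerate bounded representation maps a bounded approximate left identity to a net
that converges strongly to the identity. -/
theorem Nondeg.tendsto_approx {A : Type*} [NonUnitalNormedRing A] {T : A → (X →L[𝕜] X)}
    (hT : Nondeg T) (hmul : ∀ a b, T (a * b) = T a * T b) (hb : ∀ a, ‖T a‖ ≤ ‖a‖)
    (hc : Continuous T) {l : Filter A} {M : ℝ} (hM : ∀ᶠ u in l, ‖u‖ ≤ M)
    (hl : ∀ a, Tendsto (fun u => u * a) l (𝓝 a)) (x : X) :
    Tendsto (fun u => T u x) l (𝓝 x) := by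
  refine tendsto_of_dense_span (Φ := ContinuousLinearMap.id 𝕜 X)
    (hM.mono fun u hu => (hb u).trans hu) hT ?_ x
  rintro _ ⟨b, y, rfl⟩
  have h1 := ((hc.clm_apply continuous_const (g := fun _ => y)).tendsto b).comp (hl b)
  refine h1.congr fun u => ?_
  simp [hmul]

/-- A left multiplier of a Banach algebra with approximate left identities of bound arbitrarily
close to one acts in the space of every contractive non-degenerate representation. -/
theorem Nondeg.exists_multiplier [CompleteSpace X] {B : Type*} [NonUnitalNormedRing B]
    [NormedSpace 𝕜 B]
    (hB : ∀ ε : ℝ, 0 < ε → HasApproxLeftId B (1 + ε)) {T : B →ₙₐ[𝕜] (X →L[𝕜] X)}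
    (hT : Nondeg T) (hb : ∀ b, ‖T b‖ ≤ ‖b‖) (L : B →L[𝕜] B) (hL : ∀ b c, L (b * c) = L b * c)
    {M : ℝ} (hM0 : 0 ≤ M) (hM : ∀ b, ‖L b‖ ≤ M * ‖b‖) :
    ∃ S : X →L[𝕜] X, (∀ b x, S (T b x) = T (L b) x) ∧ ‖S‖ ≤ M := by
  have hTc : Continuous T := AddMonoidHomClass.continuous_of_bound T 1 (by simpa using hb)
  -- A tensor in $B\otimes X$ names a formal sum of vectors $T(b)x$: `e` evaluates it, `f` evaluates
  -- it after applying `L`. The operator sought sends `e t` to `f t`.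
  let TL : B →ₗ[𝕜] X →ₗ[𝕜] X := (ContinuousLinearMap.coeLM 𝕜).comp (T : B →ₗ[𝕜] (X →L[𝕜] X))
  let e : TensorProduct 𝕜 B X →ₗ[𝕜] X := TensorProduct.lift TL
  let f : TensorProduct 𝕜 B X →ₗ[𝕜] X := TensorProduct.lift (TL.comp (L : B →ₗ[𝕜] B))
  have he : ∀ b x, e (b ⊗ₜ x) = T b x := fun b x => rfl
  have hf : ∀ b x, f (b ⊗ₜ x) = T (L b) x := fun b x => rfl
  have hdense : DenseRange e := by
    have h1 : (Submodule.span 𝕜 {y | ∃ b x, T b x = y} : Submodule 𝕜 X) ≤ LinearMap.range e := by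
      rw [Submodule.span_le]
      rintro _ ⟨b, x, rfl⟩
      exact ⟨b ⊗ₜ x, he b x⟩
    exact hT.mono h1
  -- This inequality gives at once that `f t` depends only on `e t` and that the resulting operator
  -- has norm at most `M`.
  have hbound : ∀ t, ‖f t‖ ≤ M * ‖e t‖ := fun t => by
    refine le_of_forall_pos_le_add fun δ hδ => ?_
    have hpos : 0 < M * ‖e t‖ + 1 := by positivity
    -- With this choice the excess $\varepsilon M\|e(t)\|$ is at most `δ`; adding one avoids a zero
    -- denominator.
    obtain ⟨l, hl, hl1, hl2⟩ := hB (δ / (M * ‖e t‖ + 1)) (by positivity)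
    -- On elementary tensors, $T(Lu)T(b)x=T(L(ub))x\to T(Lb)x$ because `L` is a left multiplier.
    have hlim : Tendsto (fun u => T (L u) (e t)) l (𝓝 (f t)) := by
      clear hl1 hpos
      induction t using TensorProduct.induction_on with
      | zero => simp
      | add s t hs ht => simpa using hs.add ht
      | tmul b x =>
        rw [he, hf]
        have h1 : Continuous fun c => T (L c) x :=
          (hTc.comp L.continuous).clm_apply continuous_const
        refine ((h1.tendsto b).comp (hl2 b)).congr fun u => ?_
        simp [hL]
    refine le_of_tendsto hlim.norm (hl1.mono fun u hu => ?_)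
    calc ‖T (L u) (e t)‖ ≤ ‖T (L u)‖ * ‖e t‖ := (T (L u)).le_opNorm _
      _ ≤ (M * (1 + δ / (M * ‖e t‖ + 1))) * ‖e t‖ := by
          gcongr
          exact ((hb _).trans (hM u)).trans (by gcongr)
      _ = M * ‖e t‖ + (M * ‖e t‖) / (M * ‖e t‖ + 1) * δ := by ring
      _ ≤ M * ‖e t‖ + 1 * δ := by
          gcongr
          rw [div_le_one hpos]
          linarith
      _ = M * ‖e t‖ + δ := by rw [one_mul]
  refine ⟨f.extendOfNorm e, fun b x => ?_, LinearMap.opNorm_extendOfNorm_le hdense hM0 hbound⟩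
  rw [← he, LinearMap.extendOfNorm_eq hdense ⟨M, hbound⟩, hf]

end Operators

/-! ### Approximations of the point mass at the identity of the group -/

section Bump

variable (𝕜 : Type*) [RCLike 𝕜] {G : Type*} [Group G] [TopologicalSpace G] [IsTopologicalGroup G]
  [LocallyCompactSpace G] [T2Space G] [MeasurableSpace G] [BorelSpace G] (μ : Measure G)
  [μ.IsHaarMeasure] {E : Type*} [NormedAddCommGroup E] [NormedSpace 𝕜 E] [CompleteSpace E]

/-- The non-negative functions in `C_c(G)` of integral one that vanish outside `V`. -/
def bumps (V : Set G) : Set C_c(G, ℝ) :=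
  {φ | (∀ s, 0 ≤ φ s) ∧ ∫ s, φ s ∂μ = 1 ∧ ∀ s ∉ V, φ s = 0}

theorem bumps_mono : Monotone (bumps μ) := fun _ _ h _ hφ =>
  ⟨hφ.1, hφ.2.1, fun s hs => hφ.2.2 s fun hs' => hs (h hs')⟩

/-- A Urysohn function that is one at the identity and zero off the interior of `V` has positive
Haar integral, so it can be normalised. -/
theorem bumps_nonempty {V : Set G} (hV : V ∈ 𝓝 (1 : G)) : (bumps μ V).Nonempty := by
  obtain ⟨f, hf1, hf0, hfc, hf⟩ := exists_continuous_one_zero_of_isCompact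
    (isCompact_singleton (x := (1 : G))) (isOpen_interior (s := V)).isClosed_compl
    (by simpa [disjoint_singleton_left] using mem_interior_iff_mem_nhds.2 hV)
  have hpos : 0 < ∫ x, f x ∂μ :=
    f.continuous.integral_pos_of_hasCompactSupport_nonneg_nonzero hfc (fun s => (hf s).1)
      (x := 1) (by rw [hf1 (mem_singleton 1)]; exact one_ne_zero)
  refine ⟨⟨⟨fun s => (∫ x, f x ∂μ)⁻¹ * f s, by fun_prop⟩, hfc.mul_left⟩, fun s => ?_, ?_, ?_⟩
  · exact mul_nonneg (inv_nonneg.2 hpos.le) (hf s).1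
  · change ∫ s, (∫ x, f x ∂μ)⁻¹ * f s ∂μ = 1
    rw [integral_const_mul, inv_mul_cancel₀ hpos.ne']
  · intro s hs
    have : f s = 0 := hf0 fun h => hs (interior_subset h)
    change (∫ x, f x ∂μ)⁻¹ * f s = 0
    rw [this, mul_zero]

/-- The filter of tails of the approximations of the point mass at `1` in `C_c(G)`. -/
def bumpFilter : Filter C_c(G, ℝ) := (𝓝 (1 : G)).lift' (bumps μ)

instance : (bumpFilter μ).NeBot :=
  (lift'_neBot_iff (bumps_mono μ)).2 fun _ => bumps_nonempty μ

theorem eventually_bumpFilter {V : Set G} (hV : V ∈ 𝓝 (1 : G)) :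
    ∀ᶠ φ in bumpFilter μ, φ ∈ bumps μ V := mem_lift' hV

theorem smul_slice (φ : C_c(G, ℝ)) {h : G → E} (hc : Continuous h) :
    Continuous (fun s => (φ s : 𝕜) • h s) ∧ HasCompactSupport (fun s => (φ s : 𝕜) • h s) := by
  refine ⟨(RCLike.continuous_ofReal.comp φ.continuous).smul hc,
    HasCompactSupport.intro φ.hasCompactSupport fun s hs => ?_⟩
  rw [image_eq_zero_of_notMem_tsupport hs, RCLike.ofReal_zero, zero_smul]

theorem vint_smul_const (φ : C_c(G, ℝ)) (c : E) :
    vint 𝕜 μ (fun s => (φ s : 𝕜) • c) = ((∫ s, φ s ∂μ : ℝ) : 𝕜) • c := by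
  have h1 := smul_slice 𝕜 φ (continuous_const (y := (1 : 𝕜)))
  simp only [smul_eq_mul, mul_one] at h1
  have := map_vint 𝕜 (μ := μ) (ContinuousLinearMap.toSpanSingleton 𝕜 c) h1.1 h1.2
  simp only [ContinuousLinearMap.toSpanSingleton_apply] at this
  rw [← this, vint_eq_integral, integral_ofReal]

/-- As $\int\varphi=1$, the difference from $h(1)$ is $\int\varphi(s)(h(s)-h(1))\,ds$, which is
small once $\varphi$ lives where $h$ is close to $h(1)$. -/
theorem tendsto_vint_bump {h : G → E} (hc : Continuous h) :
    Tendsto (fun φ : C_c(G, ℝ) => vint 𝕜 μ fun s => (φ s : 𝕜) • h s) (bumpFilter μ)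
      (𝓝 (h 1)) := by
  rw [Metric.tendsto_nhds]
  intro ε hε
  have hV : {s | dist (h s) (h 1) < ε / 2} ∈ 𝓝 (1 : G) :=
    Metric.tendsto_nhds.1 (hc.tendsto 1) _ (half_pos hε)
  filter_upwards [eventually_bumpFilter μ hV] with φ hφ
  have h1 := smul_slice 𝕜 φ (h := fun s => h s - h 1) (hc.sub continuous_const)
  have h2 := smul_slice 𝕜 φ (continuous_const (y := h 1))
  have h3 := vint_add 𝕜 (μ := μ) h1.1 h1.2 h2.1 h2.2
  simp only [← smul_add, sub_add_cancel] at h3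
  rw [vint_smul_const, hφ.2.1, RCLike.ofReal_one, one_smul] at h3
  rw [h3, dist_eq_norm, add_sub_cancel_right]
  have hi : Integrable (fun s => φ s) μ :=
    φ.continuous.integrable_of_hasCompactSupport φ.hasCompactSupport
  calc ‖vint 𝕜 μ fun s => (φ s : 𝕜) • (h s - h 1)‖
      ≤ ∫ s, ‖(φ s : 𝕜) • (h s - h 1)‖ ∂μ := norm_vint_le 𝕜 μ _
    _ ≤ ∫ s, φ s * (ε / 2) ∂μ := by
        refine integral_mono (h1.1.norm.integrable_of_hasCompactSupport h1.2.norm)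
          (hi.mul_const _) fun s => ?_
        simp only [norm_smul, RCLike.norm_ofReal, abs_of_nonneg (hφ.1 s)]
        by_cases hs : s ∈ {s | dist (h s) (h 1) < ε / 2}
        · refine mul_le_mul_of_nonneg_left ?_ (hφ.1 s)
          rw [← dist_eq_norm]
          exact le_of_lt hs
        · simp [hφ.2.2 s hs]
    _ = ε / 2 := by rw [integral_mul_const, hφ.2.1, one_mul]
    _ < ε := half_lt_self hε

/-- The integral of a function with values in a closed subspace belongs to this subspace. -/
theorem vint_mem {f : G → E} (hf : Continuous f) (hf' : HasCompactSupport f)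
    {Z : Submodule 𝕜 E} (hZ : IsClosed (Z : Set E)) (h : ∀ s, f s ∈ Z) : vint 𝕜 μ f ∈ Z := by
  -- The function is integrated inside the Banach space `Z`, and the inclusion of `Z` commutes with
  -- the integral.
  have : CompleteSpace Z := hZ.completeSpace_coe
  have hc : Continuous fun s => (⟨f s, h s⟩ : Z) := hf.subtype_mk _
  have hc' : HasCompactSupport fun s => (⟨f s, h s⟩ : Z) :=
    HasCompactSupport.intro hf' fun s hs =>
      Subtype.ext (by simpa using image_eq_zero_of_notMem_tsupport hs)
  have := map_vint 𝕜 (μ := μ) Z.subtypeL hc hc'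
  exact this ▸ Subtype.coe_prop _

end Bump

/-! ### Covariant representations compared with their integrated forms -/

section IntegratedForms

variable {𝕜 : Type v} [RCLike 𝕜]
  {A : Type*} [NonUnitalNormedRing A] [NormedSpace 𝕜 A] [IsScalarTower 𝕜 A A]
  [SMulCommClass 𝕜 A A] [CompleteSpace A]
  {G : Type*} [Group G] [TopologicalSpace G] [IsTopologicalGroup G] [LocallyCompactSpace G]
  [T2Space G] [MeasurableSpace G] [BorelSpace G] (μ : Measure G) [μ.IsHaarMeasure]
  {α : DynSys 𝕜 A G}
  {X : Type*} [NormedAddCommGroup X] [NormedSpace 𝕜 X] [CompleteSpace X]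
  {Y : Type*} [NormedAddCommGroup Y] [NormedSpace 𝕜 Y] [CompleteSpace Y]

variable (𝕜) in
/-- The elementary tensor `s ↦ φ(s) a` in `C_c(G, A)`. -/
def ccTensor (φ : C_c(G, ℝ)) (a : A) : C_c(G, A) where
  toFun s := (φ s : 𝕜) • a
  continuous_toFun := (smul_slice 𝕜 φ continuous_const).1
  hasCompactSupport' := (smul_slice 𝕜 φ continuous_const).2

variable (α) in
/-- The left action `s ↦ α_t(f(t⁻¹ s))` of the group on `C_c(G, A)`. -/
def ccTrans (t : G) (f : C_c(G, A)) : C_c(G, A) where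
  toFun s := α.act t (f (t⁻¹ * s))
  continuous_toFun := (α.act t).continuous.comp (f.continuous.comp (continuous_const_mul _))
  hasCompactSupport' :=
    (f.hasCompactSupport.comp_homeomorph (Homeomorph.mulLeft t⁻¹)).comp_left (map_zero (α.act t))

/-- The left action `s ↦ a f(s)` of the algebra on `C_c(G, A)`. -/
def ccMul (a : A) (f : C_c(G, A)) : C_c(G, A) where
  toFun s := a * f s
  continuous_toFun := continuous_const.mul f.continuous
  hasCompactSupport' := f.hasCompactSupport.mul_left

theorem U_inv_apply (p : ContCovRep α X) (s : G) (x : X) : p.U s⁻¹ (p.U s x) = x := by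
  change (p.U s⁻¹ * p.U s) x = x
  rw [← map_mul]
  simp

theorem intForm_ccTensor (p : ContCovRep α X) (φ : C_c(G, ℝ)) (a : A) (x : X) :
    intForm μ p (ccTensor 𝕜 φ a) x = vint 𝕜 μ fun s => (φ s : 𝕜) • p.π a (p.U s x) := by
  rw [intForm_apply]
  congr 1
  ext s
  change p.π ((φ s : 𝕜) • a) _ = _
  rw [map_smul]
  rfl

theorem intForm_ccMul (p : ContCovRep α X) (a : A) (f : C_c(G, A)) :
    intForm μ p (ccMul a f) = p.π a * intForm μ p f := by
  ext x
  have h := intIntegrand p f x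
  refine Eq.trans ?_ (map_vint 𝕜 (μ := μ) (p.π a) h.1 h.2).symm
  rw [intForm_apply]
  congr 1
  ext s
  change p.π (a * f s) _ = _
  rw [map_mul]
  rfl

/-- After the substitution $s\mapsto ts$, covariance gives
$\pi(\alpha_t(f(s)))U_{ts}=U_t\pi(f(s))U_s$. -/
theorem intForm_ccTrans (p : ContCovRep α X) (t : G) (f : C_c(G, A)) :
    intForm μ p (ccTrans α t f) = p.U t * intForm μ p f := by
  ext x
  have h := intIntegrand p f x
  refine Eq.trans ?_ (map_vint 𝕜 (μ := μ) (p.U t) h.1 h.2).symm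
  rw [intForm_apply, ← vint_mul_left 𝕜 μ _ t]
  congr 1
  ext s
  change p.π (α.act t (f (t⁻¹ * (t * s)))) _ = _
  rw [p.covariant, inv_mul_cancel_left, map_mul]
  simp [U_inv_apply]

/-- This recovers $\pi$ from the integrated form: $s\mapsto\pi(a)U_sx$ is continuous with value
$\pi(a)x$ at the identity. -/
theorem tendsto_intForm_ccTensor (p : ContCovRep α X) (a : A) (x : X) :
    Tendsto (fun φ => intForm μ p (ccTensor 𝕜 φ a) x) (bumpFilter μ) (𝓝 (p.π a x)) := by
  simp only [intForm_ccTensor]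
  have := tendsto_vint_bump 𝕜 μ (h := fun s => p.π a (p.U s x))
    ((p.π a).continuous.comp (p.continuous_U x))
  simpa using this

theorem nondeg_intForm (p : ContCovRep α X) (hp : Nondeg p.π) : Nondeg (intForm μ p) := by
  rw [Nondeg, dense_iff_closure_eq, ← univ_subset_iff, ← hp.closure_eq]
  refine closure_minimal ?_ isClosed_closure
  rw [← Submodule.topologicalClosure_coe, SetLike.coe_subset_coe, Submodule.span_le]
  rintro _ ⟨a, x, rfl⟩
  exact mem_closure_of_tendsto (tendsto_intForm_ccTensor μ p a x)
    (Eventually.of_forall fun φ => Submodule.subset_span ⟨_, _, rfl⟩)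

/-- To show $U_tz\in Z$, the vector $z$ has to be approximated from within $Z$. This is the role of
`happrox`: $U_tz=\lim_u U_t\pi(u)z$, and $U_t\pi(u)z$ is the limit of integrated forms of translates
of $\varphi\otimes u$ applied to $z$. -/
theorem invariant_intForm_iff {p : ContCovRep α X}
    (happrox : ∃ l : Filter A, l.NeBot ∧ ∀ x, Tendsto (fun u => p.π u x) l (𝓝 x))
    {Z : Submodule 𝕜 X} (hZ : IsClosed (Z : Set X)) :
    Invariant p.π Z ∧ Invariant p.U Z ↔ Invariant (intForm μ p) Z := by
  refine ⟨fun h f z hz => ?_, fun h => ⟨fun a z hz => ?_, fun t z hz => ?_⟩⟩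
  · have h1 := intIntegrand p f z
    exact vint_mem 𝕜 μ h1.1 h1.2 hZ fun s => h.1 _ _ (h.2 _ _ hz)
  · exact hZ.mem_of_tendsto (tendsto_intForm_ccTensor μ p a z)
      (Eventually.of_forall fun φ => h _ z hz)
  · obtain ⟨l, hl, hlim⟩ := happrox
    refine hZ.mem_of_tendsto (((p.U t).continuous.tendsto z).comp (hlim z))
      (Eventually.of_forall fun u => ?_)
    refine hZ.mem_of_tendsto (((p.U t).continuous.tendsto _).comp
      (tendsto_intForm_ccTensor μ p u z)) (Eventually.of_forall fun φ => ?_)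
    have h1 := h (ccTrans α t (ccTensor 𝕜 φ u)) z hz
    rwa [intForm_ccTrans] at h1

/-- For the group part, both operators need only be compared on the vectors $\pi\rtimes U(f)x$,
whose span is dense, and there `intForm_ccTrans` applies. -/
theorem intertwines_intForm_iff {p : ContCovRep α X} {q : ContCovRep α Y} (hp : Nondeg p.π)
    (Φ : X →L[𝕜] Y) :
    Intertwines p.π q.π Φ ∧ Intertwines p.U q.U Φ ↔
      Intertwines (intForm μ p) (intForm μ q) Φ := by
  refine ⟨fun h f => ?_, fun h => ⟨fun a => ?_, fun t => ?_⟩⟩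
  · ext x
    have h1 := intIntegrand p f x
    refine Eq.trans ?_ (map_vint 𝕜 (μ := μ) Φ h1.1 h1.2).symm
    change intForm μ q f (Φ x) = _
    rw [intForm_apply]
    congr 1
    ext s
    have h2 := DFunLike.congr_fun (h.1 (f s)) (p.U s x)
    have h3 := DFunLike.congr_fun (h.2 s) x
    simp only [ContinuousLinearMap.comp_apply] at h2 h3
    rw [h3, h2]
  · ext x
    refine tendsto_nhds_unique (tendsto_intForm_ccTensor μ q a (Φ x)) ?_
    refine ((Φ.continuous.tendsto _).comp (tendsto_intForm_ccTensor μ p a x)).congr fun φ => ?_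
    exact (DFunLike.congr_fun (h (ccTensor 𝕜 φ a)) x).symm
  · refine (nondeg_intForm μ p hp).ext fun f x => ?_
    have h1 := DFunLike.congr_fun (h (ccTrans α t f)) x
    have h2 := DFunLike.congr_fun (h f) x
    rw [intForm_ccTrans, intForm_ccTrans] at h1
    simp only [ContinuousLinearMap.comp_apply, _root_.mul_apply_eq_comp] at h1 h2 ⊢
    rw [← h1, h2]

end IntegratedForms

/-! ### Left multipliers and approximate left identities of the crossed product -/

section CrossedProductMultipliers

variable {𝕜 : Type v} [RCLike 𝕜]
  {A : Type*} [NonUnitalNormedRing A] [NormedSpace 𝕜 A] [IsScalarTower 𝕜 A A]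
  [SMulCommClass 𝕜 A A] [CompleteSpace A]
  {G : Type*} [Group G] [TopologicalSpace G] [IsTopologicalGroup G] [LocallyCompactSpace G]
  [T2Space G] [MeasurableSpace G] [BorelSpace G] (μ : Measure G) [μ.IsHaarMeasure]
  {α : DynSys 𝕜 A G} {R : UBClass.{v, w} α}

/-- Every `(π, U)` in `R` consists of contractions. -/
def UBClass.IsContractive (R : UBClass.{v, w} α) : Prop :=
  ∀ p ∈ R.carrier, (∀ a, ‖p.2.π a‖ ≤ ‖a‖) ∧ ∀ r, ‖p.2.U r‖ ≤ 1

theorem UBClass.IsContractive.norm_intForm_le (hR : R.IsContractive)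
    {p : Σ X : BanachSp.{v, w} 𝕜, ContCovRep α X} (hp : p ∈ R.carrier) (f : C_c(G, A)) :
    ‖intForm μ p.2 f‖ ≤ ∫ s, ‖f s‖ ∂μ := by
  refine ContinuousLinearMap.opNorm_le_bound _ (by positivity) fun x => ?_
  have := CrossedProd.norm_intForm_le μ p.2 f zero_le_one (M := 1)
    (by simpa using (hR p hp).1) (fun s _ => (hR p hp).2 s) x
  simpa [intForm_apply] using this

/-- Domination by the $L^1$-norm turns $L^1$-convergence in $C_c(G,A)$ into convergence in the
crossed product. -/
theorem UBClass.IsContractive.sigma_le_integral (hR : R.IsContractive) (f : C_c(G, A)) :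
    sigma μ R f ≤ ∫ s, ‖f s‖ ∂μ :=
  sigma_le μ R fun _ hp => hR.norm_intForm_le μ hp f

/-- The canonical map of `C_c(G, A)` into the crossed product, as a function on `C_c(G, A)`. -/
noncomputable def toCP (R : UBClass.{v, w} α) (f : C_c(G, A)) : CrossedProduct μ R := quot μ R f

theorem norm_toCP (f : C_c(G, A)) : ‖toCP μ R f‖ = sigma μ R f := norm_quot μ R f

theorem denseRange_toCP : DenseRange (toCP μ R) := denseRange_quot μ R

theorem toCP_sub (f g : C_c(G, A)) : toCP μ R (f - g) = toCP μ R f - toCP μ R g :=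
  map_sub (quot μ R) f g

theorem intRep_toCP {X : Type*} [NormedAddCommGroup X] [NormedSpace 𝕜 X] [CompleteSpace X]
    {p : ContCovRep α X} (hp : IsRCont μ R p) (f : C_c(G, A)) :
    intRep μ hp (toCP μ R f) = intForm μ p f := intRep_quot μ hp f

theorem norm_intRep_le {p : Σ X : BanachSp.{v, w} 𝕜, ContCovRep α X} (hp : p ∈ R.carrier)
    (b : CrossedProduct μ R) : ‖intRep μ (isRCont_of_mem μ hp) b‖ ≤ ‖b‖ :=
  (denseRange_toCP μ (R := R)).induction_on b
    (isClosed_le (continuous_intRep μ _).norm continuous_norm) fun f => by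
      rw [intRep_toCP, norm_toCP]
      exact norm_intForm_le_sigma μ R f hp

/-- The representations `(π ⋊ U)^R` with `(π, U)` in `R` separate the points of the crossed
product. -/
theorem crossedProduct_ext {b c : CrossedProduct μ R}
    (h : ∀ p (hp : p ∈ R.carrier),
      intRep μ (isRCont_of_mem μ hp) b = intRep μ (isRCont_of_mem μ hp) c) : b = c := by
  rw [← sub_eq_zero, ← norm_le_zero_iff]
  refine le_of_forall_pos_le_add fun ε hε => ?_
  -- By definition the norm is a supremum over `R` only on the image of $C_c(G,A)$, hence the
  -- approximation of `b - c` by an element of that image.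
  obtain ⟨f, hf⟩ := (denseRange_toCP μ (R := R)).exists_dist_lt (b - c) (half_pos hε)
  rw [dist_eq_norm] at hf
  have h1 : ‖toCP μ R f‖ ≤ ε / 2 := by
    rw [norm_toCP]
    refine sigma_le μ R fun p hp => ?_
    have h2 := norm_intRep_le μ hp (b - c - toCP μ R f)
    rw [map_sub, map_sub, h p hp, sub_self, zero_sub, norm_neg, intRep_toCP] at h2
    exact h2.trans hf.le
  have h2 : ‖b - c‖ ≤ ‖b - c - toCP μ R f‖ + ‖toCP μ R f‖ := by
    simpa using norm_add_le (b - c - toCP μ R f) (toCP μ R f)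
  linarith

/-- The extension to the crossed product of a `σ^R`-bounded linear map on `C_c(G, A)`. -/
noncomputable def cpLift {L : CcAlg μ R →ₗ[𝕜] CcAlg μ R} {M : ℝ} (hL : ∀ f, ‖L f‖ ≤ M * ‖f‖) :
    CrossedProduct μ R →L[𝕜] CrossedProduct μ R :=
  ((quot μ R).comp (L.mkContinuous M hL)).extend (quot μ R)

theorem cpLift_quot {L : CcAlg μ R →ₗ[𝕜] CcAlg μ R} {M : ℝ} (hL : ∀ f, ‖L f‖ ≤ M * ‖f‖)
    (f : CcAlg μ R) : cpLift μ hL (quot μ R f) = quot μ R (L f) :=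
  ContinuousLinearMap.extend_eq _ (denseRange_quot μ R) (isUniformInducing_quot μ) f

theorem norm_cpLift_le {L : CcAlg μ R →ₗ[𝕜] CcAlg μ R} {M : ℝ} (hL : ∀ f, ‖L f‖ ≤ M * ‖f‖)
    (b : CrossedProduct μ R) : ‖cpLift μ hL b‖ ≤ M * ‖b‖ :=
  (denseRange_quot μ R).induction_on b
    (isClosed_le (cpLift μ hL).continuous.norm (continuous_const.mul continuous_norm)) fun f => by
      rw [cpLift_quot, norm_quot, norm_quot]
      exact hL f

variable (α) in
/-- The linear map `ccMul a`. -/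
def ccMulL (R : UBClass.{v, w} α) (a : A) : CcAlg μ R →ₗ[𝕜] CcAlg μ R where
  toFun f := ccMul a f
  map_add' f g := CompactlySupportedContinuousMap.ext fun s => mul_add a (f.1 s) (g.1 s)
  map_smul' c f := CompactlySupportedContinuousMap.ext fun s => mul_smul_comm c a (f.1 s)

/-- The linear map `ccTrans α t`. -/
def ccTransL (R : UBClass.{v, w} α) (t : G) : CcAlg μ R →ₗ[𝕜] CcAlg μ R where
  toFun f := ccTrans α t f
  map_add' f g := CompactlySupportedContinuousMap.ext fun s =>
    map_add (α.act t) (f.1 (t⁻¹ * s)) (g.1 (t⁻¹ * s))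
  map_smul' c f := CompactlySupportedContinuousMap.ext fun s =>
    map_smul (α.act t) c (f.1 (t⁻¹ * s))

theorem UBClass.IsContractive.norm_ccMulL_le (hR : R.IsContractive) (a : A) (f : CcAlg μ R) :
    ‖ccMulL μ α R a f‖ ≤ ‖a‖ * ‖f‖ :=
  sigma_le μ R fun p hp => by
    refine (congrArg norm (intForm_ccMul μ p.2 a f)).trans_le ?_
    exact (norm_mul_le _ _).trans (mul_le_mul ((hR p hp).1 a) (norm_intForm_le_sigma μ R f hp)
      (norm_nonneg _) (norm_nonneg _))

theorem UBClass.IsContractive.norm_ccTransL_le (hR : R.IsContractive) (t : G) (f : CcAlg μ R) :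
    ‖ccTransL μ R t f‖ ≤ 1 * ‖f‖ :=
  sigma_le μ R fun p hp => by
    refine (congrArg norm (intForm_ccTrans μ p.2 t f)).trans_le ?_
    exact (norm_mul_le _ _).trans (mul_le_mul ((hR p hp).2 t) (norm_intForm_le_sigma μ R f hp)
      (norm_nonneg _) zero_le_one)

/-- The left multiplier of the crossed product given by an element of `A`. -/
noncomputable def cpMul (hR : R.IsContractive) (a : A) :
    CrossedProduct μ R →L[𝕜] CrossedProduct μ R :=
  cpLift μ (hR.norm_ccMulL_le μ a)

/-- The left multiplier of the crossed product given by an element of `G`. -/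
noncomputable def cpTrans (hR : R.IsContractive) (t : G) :
    CrossedProduct μ R →L[𝕜] CrossedProduct μ R :=
  cpLift μ (hR.norm_ccTransL_le μ t)

theorem cpMul_toCP (hR : R.IsContractive) (a : A) (f : C_c(G, A)) :
    cpMul μ hR a (toCP μ R f) = toCP μ R (ccMul a f) := cpLift_quot μ _ f

theorem cpTrans_toCP (hR : R.IsContractive) (t : G) (f : C_c(G, A)) :
    cpTrans μ hR t (toCP μ R f) = toCP μ R (ccTrans α t f) := cpLift_quot μ _ f

theorem norm_cpMul_le (hR : R.IsContractive) (a : A) (b : CrossedProduct μ R) :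
    ‖cpMul μ hR a b‖ ≤ ‖a‖ * ‖b‖ := norm_cpLift_le μ _ b

theorem norm_cpTrans_le (hR : R.IsContractive) (t : G) (b : CrossedProduct μ R) :
    ‖cpTrans μ hR t b‖ ≤ 1 * ‖b‖ := norm_cpLift_le μ _ b

/-- With `crossedProduct_ext`, this lemma and `intRep_cpTrans` reduce every identity between
multipliers to the same identity for $\pi$ and $U$. -/
theorem intRep_cpMul (hR : R.IsContractive) {p : Σ X : BanachSp.{v, w} 𝕜, ContCovRep α X}
    (hp : IsRCont μ R p.2) (a : A) (b : CrossedProduct μ R) :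
    intRep μ hp (cpMul μ hR a b) = p.2.π a * intRep μ hp b :=
  (denseRange_toCP μ (R := R)).induction_on b
    (isClosed_eq ((continuous_intRep μ hp).comp (cpMul μ hR a).continuous)
      (continuous_const.mul (continuous_intRep μ hp))) fun f => by
    rw [cpMul_toCP, intRep_toCP, intRep_toCP, ← intForm_ccMul]

theorem intRep_cpTrans (hR : R.IsContractive) {p : Σ X : BanachSp.{v, w} 𝕜, ContCovRep α X}
    (hp : IsRCont μ R p.2) (t : G) (b : CrossedProduct μ R) :
    intRep μ hp (cpTrans μ hR t b) = p.2.U t * intRep μ hp b :=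
  (denseRange_toCP μ (R := R)).induction_on b
    (isClosed_eq ((continuous_intRep μ hp).comp (cpTrans μ hR t).continuous)
      (continuous_const.mul (continuous_intRep μ hp))) fun f => by
    rw [cpTrans_toCP, intRep_toCP, intRep_toCP, ← intForm_ccTrans]

theorem cpMul_mul (hR : R.IsContractive) (a : A) (b c : CrossedProduct μ R) :
    cpMul μ hR a (b * c) = cpMul μ hR a b * c :=
  crossedProduct_ext μ fun p hp => by simp only [intRep_cpMul, map_mul, mul_assoc]

theorem cpTrans_mul (hR : R.IsContractive) (t : G) (b c : CrossedProduct μ R) :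
    cpTrans μ hR t (b * c) = cpTrans μ hR t b * c :=
  crossedProduct_ext μ fun p hp => by simp only [intRep_cpTrans, map_mul, mul_assoc]

theorem continuous_ccTrans_uncurry (f : C_c(G, A)) :
    Continuous fun q : G × G => ccTrans α q.1 f q.2 :=
  α.continuous_joint.comp (f := fun q : G × G => (q.1, f (q.1⁻¹ * q.2))) (by fun_prop)

/-- For $s$ in a compact neighbourhood $K$ of $t$, all translates vanish off the compact set
$K\cdot\operatorname{supp}f$. The integral is therefore continuous in $s$ on $K$, and it is zero at
$s=t$. -/
theorem tendsto_integral_ccTrans (f : C_c(G, A)) (t : G) :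
    Tendsto (fun s => ∫ r, ‖ccTrans α s f r - ccTrans α t f r‖ ∂μ) (𝓝 t) (𝓝 0) := by
  obtain ⟨K, hK, hKt⟩ := exists_compact_mem_nhds t
  have hk : IsCompact ((fun q : G × G => q.1 * q.2) '' (K ×ˢ tsupport f)) :=
    (hK.prod f.hasCompactSupport).image continuous_mul
  have hz : ∀ s x, s ∈ K → x ∉ (fun q : G × G => q.1 * q.2) '' (K ×ˢ tsupport f) →
      ccTrans α s f x = 0 := fun s x hs hx => by
    have : s⁻¹ * x ∉ tsupport f := fun h => hx ⟨(s, s⁻¹ * x), ⟨hs, h⟩, by simp⟩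
    change α.act s (f (s⁻¹ * x)) = 0
    rw [image_eq_zero_of_notMem_tsupport this, map_zero]
  have hc : ContinuousOn (fun s => ∫ r, ‖ccTrans α s f r - ccTrans α t f r‖ ∂μ) K := by
    refine continuousOn_integral_of_compact_support hk ?_ fun s x hs hx => ?_
    · exact ((continuous_ccTrans_uncurry f).sub
        ((ccTrans α t f).continuous.comp continuous_snd)).norm.continuousOn
    · rw [hz s x hs hx, hz t x (mem_of_mem_nhds hKt) hx, sub_zero, norm_zero]
  have := (hc.continuousAt hKt).tendsto
  simpa using this

theorem tendsto_toCP (hR : R.IsContractive) {ι : Type*} {l : Filter ι} {F : ι → C_c(G, A)}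
    {f : C_c(G, A)} (h : Tendsto (fun i => ∫ r, ‖F i r - f r‖ ∂μ) l (𝓝 0)) :
    Tendsto (fun i => toCP μ R (F i)) l (𝓝 (toCP μ R f)) := by
  rw [tendsto_iff_norm_sub_tendsto_zero]
  refine squeeze_zero (fun _ => norm_nonneg _) (fun i => ?_) h
  rw [← toCP_sub, norm_toCP]
  exact hR.sigma_le_integral μ (F i - f)

theorem dense_span_range_toCP :
    Dense (Submodule.span 𝕜 (range (toCP μ R)) : Set (CrossedProduct μ R)) :=
  (denseRange_toCP μ).mono Submodule.subset_span

theorem continuous_cpTrans (hR : R.IsContractive) (b : CrossedProduct μ R) :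
    Continuous fun t => cpTrans μ hR t b := by
  rw [continuous_iff_continuousAt]
  intro t
  refine tendsto_of_dense_span (M := 1) (Eventually.of_forall fun s =>
    ContinuousLinearMap.opNorm_le_bound _ zero_le_one (norm_cpTrans_le μ hR s))
    (dense_span_range_toCP μ) ?_ b
  rintro _ ⟨f, rfl⟩
  simp only [cpTrans_toCP]
  exact tendsto_toCP μ hR (tendsto_integral_ccTrans μ f t)

/-- The canonical covariant representation on the crossed product by left multipliers. -/
noncomputable def cpRep (hR : R.IsContractive) : ContCovRep α (CrossedProduct μ R) where
  π :=
    { toFun := cpMul μ hR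
      map_smul' := fun c a => by
        ext b
        refine crossedProduct_ext μ fun p hp => ?_
        simp [intRep_cpMul, map_smul]
      map_zero' := by
        ext b
        refine crossedProduct_ext μ fun p hp => ?_
        simp [intRep_cpMul]
      map_add' := fun a a' => by
        ext b
        refine crossedProduct_ext μ fun p hp => ?_
        simp [intRep_cpMul, map_add, add_mul]
      map_mul' := fun a a' => by
        ext b
        refine crossedProduct_ext μ fun p hp => ?_
        simp [intRep_cpMul, mul_assoc] }
  U :=
    { toFun := cpTrans μ hR
      map_one' := by
        ext b
        refine crossedProduct_ext μ fun p hp => ?_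
        simp [intRep_cpTrans]
      map_mul' := fun s t => by
        ext b
        refine crossedProduct_ext μ fun p hp => ?_
        simp [intRep_cpTrans, mul_assoc] }
  covariant a s := by
    ext b
    refine crossedProduct_ext μ fun p hp => ?_
    change intRep μ (isRCont_of_mem μ hp) (cpMul μ hR (α.act s a) b) = intRep μ _
      (cpTrans μ hR s (cpMul μ hR a (cpTrans μ hR s⁻¹ b)))
    simp only [intRep_cpMul, intRep_cpTrans, p.2.covariant, mul_assoc]
  bounded := ⟨1, fun a => ContinuousLinearMap.opNorm_le_bound _ (by positivity) fun b => by
    rw [one_mul]; exact norm_cpMul_le μ hR a b⟩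
  continuous_U := continuous_cpTrans μ hR

theorem cpRep_U_apply (hR : R.IsContractive) (t : G) : (cpRep μ hR).U t = cpTrans μ hR t := rfl

/-- The integrated form of the canonical representation is left multiplication. -/
theorem intForm_cpRep (hR : R.IsContractive) (f : C_c(G, A)) (b : CrossedProduct μ R) :
    intForm μ (cpRep μ hR) f b = toCP μ R f * b := by
  refine crossedProduct_ext μ fun p hp => ?_
  rw [map_mul, intRep_toCP]
  ext x
  have h := intIntegrand (cpRep μ hR) f b
  -- Applying a member of `R` under the integral sign turns the multipliers into $\pi(f(s))U_s$.
  refine (map_vint 𝕜 (μ := μ) ((ContinuousLinearMap.apply 𝕜 p.1 x).comp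
    (intRepL μ (isRCont_of_mem μ hp))) h.1 h.2).trans ?_
  change _ = intForm μ p.2 f (intRep μ (isRCont_of_mem μ hp) b x)
  rw [intForm_apply]
  congr 1
  ext s
  change intRep μ (isRCont_of_mem μ hp) (cpMul μ hR (f s) (cpTrans μ hR s b)) x = _
  rw [intRep_cpMul, intRep_cpTrans]
  rfl

/-- A bounded approximate left identity converges uniformly on the compact range of $f$, and the
support of $f$ has finite measure. -/
theorem tendsto_integral_ccMul {l : Filter A} {M : ℝ} (hM : ∀ᶠ u in l, ‖u‖ ≤ M)
    (hl : ∀ a, Tendsto (fun u => u * a) l (𝓝 a)) (f : C_c(G, A)) :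
    Tendsto (fun u => ∫ s, ‖ccMul u f s - f s‖ ∂μ) l (𝓝 0) := by
  have hunif : ∀ δ : ℝ, 0 < δ → ∀ᶠ u in l, ∀ c ∈ range f, ‖u * c - c‖ < δ := fun δ hδ => by
    refine (f.hasCompactSupport.isCompact_range f.continuous).induction_on
      (p := fun S => ∀ᶠ u in l, ∀ c ∈ S, ‖u * c - c‖ < δ) ?_ ?_ ?_ ?_
    · simp
    · exact fun S T hST hT => hT.mono fun u hu c hc => hu c (hST hc)
    · intro S T hS hT
      filter_upwards [hS, hT] with u hu hu' c hc
      exact hc.elim (hu c) (hu' c)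
    · intro a _
      -- On the ball of this radius around `a`, passing from `a` to `c` costs at most
      -- $(M+1)\|c-a\|<\delta/2$.
      have hpos : 0 < δ / 2 / (max M 0 + 1) := by positivity
      refine ⟨_, mem_nhdsWithin_of_mem_nhds (Metric.ball_mem_nhds a hpos), ?_⟩
      filter_upwards [hM, Metric.tendsto_nhds.1 (hl a) (δ / 2) (by positivity)] with u hu hu' c hc
      rw [mem_ball_iff_norm, lt_div_iff₀ (by positivity)] at hc
      rw [dist_eq_norm] at hu'
      calc ‖u * c - c‖ = ‖u * (c - a) + (u * a - a) - (c - a)‖ := by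
            congr 1; rw [mul_sub]; abel
        _ ≤ ‖u * (c - a)‖ + ‖u * a - a‖ + ‖c - a‖ :=
            (norm_sub_le _ _).trans (by gcongr; exact norm_add_le _ _)
        _ ≤ max M 0 * ‖c - a‖ + ‖u * a - a‖ + ‖c - a‖ := by
            gcongr
            exact (norm_mul_le _ _).trans (by gcongr; exact hu.trans (le_max_left _ _))
        _ < δ := by linarith
  have hfin : μ (tsupport f) ≠ ⊤ := f.hasCompactSupport.isCompact.measure_lt_top.ne
  rw [Metric.tendsto_nhds]
  intro ε hε
  have hpos : 0 < ε / (μ.real (tsupport f) + 1) := by positivity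
  filter_upwards [hunif _ hpos] with u hu
  rw [dist_zero_right, Real.norm_of_nonneg (by positivity)]
  have hs : ∫ s, ‖ccMul u f s - f s‖ ∂μ = ∫ s in tsupport f, ‖ccMul u f s - f s‖ ∂μ := by
    refine (setIntegral_eq_integral_of_forall_compl_eq_zero fun s hs => ?_).symm
    change ‖u * f s - f s‖ = 0
    simp [image_eq_zero_of_notMem_tsupport hs]
  rw [hs]
  calc ∫ s in tsupport f, ‖ccMul u f s - f s‖ ∂μ
      ≤ ‖∫ s in tsupport f, ‖ccMul u f s - f s‖ ∂μ‖ := le_abs_self _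
    _ ≤ ε / (μ.real (tsupport f) + 1) * μ.real (tsupport f) :=
        norm_setIntegral_le_of_norm_le_const hfin.lt_top fun s _ => by
          rw [norm_norm]; exact (hu _ (mem_range_self s)).le
    _ < ε := by
        rw [div_mul_eq_mul_div, div_lt_iff₀ (by positivity)]
        nlinarith [measureReal_nonneg (μ := μ) (s := tsupport f)]

theorem tendsto_cpMul (hR : R.IsContractive) {l : Filter A} {M : ℝ} (hM : ∀ᶠ u in l, ‖u‖ ≤ M)
    (hl : ∀ a, Tendsto (fun u => u * a) l (𝓝 a)) (b : CrossedProduct μ R) :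
    Tendsto (fun u => cpMul μ hR u b) l (𝓝 b) := by
  refine tendsto_of_dense_span (Φ := ContinuousLinearMap.id 𝕜 _) (hM.mono fun u hu =>
    (ContinuousLinearMap.opNorm_le_bound _ (norm_nonneg u) (norm_cpMul_le μ hR u)).trans hu)
    (dense_span_range_toCP μ) ?_ b
  rintro _ ⟨f, rfl⟩
  exact (tendsto_toCP μ hR (tendsto_integral_ccMul μ hM hl f)).congr fun u =>
    (cpMul_toCP μ hR u f).symm

/-- The $L^1$-norm of $\varphi\otimes a$ is exactly $\|a\|$, so the bound of an approximate identity
passes to the crossed product without loss. -/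
theorem norm_toCP_ccTensor_le (hR : R.IsContractive) {V : Set G} {φ : C_c(G, ℝ)}
    (hφ : φ ∈ bumps μ V) (a : A) : ‖toCP μ R (ccTensor 𝕜 φ a)‖ ≤ ‖a‖ := by
  rw [norm_toCP]
  refine (hR.sigma_le_integral μ _).trans (le_of_eq ?_)
  change ∫ s, ‖(φ s : 𝕜) • a‖ ∂μ = _
  simp only [norm_smul, RCLike.norm_ofReal, abs_of_nonneg (hφ.1 _)]
  rw [integral_mul_const, hφ.2.1, one_mul]

/-- By `intForm_cpRep`, multiplying $b$ by $q^{\mathcal R}(\varphi\otimes u)$ averages the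
translates of $b$ against $\varphi$ and then multiplies by $u$. The average tends to $b$ as
$\varphi$ concentrates, and the multipliers $u$ are bounded and tend strongly to the identity, so
$\varphi$ and $u$ may vary independently. -/
theorem UBClass.IsContractive.hasApproxLeftId (hR : R.IsContractive) {M : ℝ}
    (hA : HasApproxLeftId A M) : HasApproxLeftId (CrossedProduct μ R) M := by
  obtain ⟨l, hl, hM, hlim⟩ := hA
  refine ⟨(bumpFilter μ ×ˢ l).map fun q => toCP μ R (ccTensor 𝕜 q.1 q.2), inferInstance, ?_,
    fun b => ?_⟩
  · rw [eventually_map]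
    filter_upwards [(eventually_bumpFilter μ univ_mem).prod_mk hM] with q hq
    exact (norm_toCP_ccTensor_le μ hR hq.1 q.2).trans hq.2
  · rw [tendsto_map'_iff]
    let c : C_c(G, ℝ) → CrossedProduct μ R := fun φ =>
      vint 𝕜 μ fun s => (φ s : 𝕜) • cpTrans μ hR s b
    have hc : Tendsto c (bumpFilter μ) (𝓝 b) := by
      have := tendsto_vint_bump 𝕜 μ (continuous_cpTrans μ hR b)
      rwa [← cpRep_U_apply, map_one] at this
    have hq : ∀ q : C_c(G, ℝ) × A, toCP μ R (ccTensor 𝕜 q.1 q.2) * b = cpMul μ hR q.2 (c q.1) :=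
      fun q => by
        have h1 := smul_slice 𝕜 q.1 (continuous_cpTrans μ hR b)
        rw [← intForm_cpRep μ hR, intForm_ccTensor, map_vint 𝕜 (cpMul μ hR q.2) h1.1 h1.2]
        simp only [map_smul]
        rfl
    have h1 : Tendsto (fun q : C_c(G, ℝ) × A => cpMul μ hR q.2 (c q.1 - b)) (bumpFilter μ ×ˢ l)
        (𝓝 0) := by
      have h2 : Tendsto (fun q : C_c(G, ℝ) × A => max M 0 * ‖c q.1 - b‖) (bumpFilter μ ×ˢ l)
          (𝓝 0) := by
        have := ((tendsto_iff_norm_sub_tendsto_zero.1 hc).comp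
          (tendsto_fst (g := l))).const_mul (max M 0)
        simpa using this
      refine squeeze_zero_norm' ?_ h2
      filter_upwards [tendsto_snd.eventually hM] with q hq'
      exact (norm_cpMul_le μ hR _ _).trans (by gcongr; exact hq'.trans (le_max_left _ _))
    have h3 := h1.add ((tendsto_cpMul μ hR hM hlim b).comp (tendsto_snd (f := bumpFilter μ)))
    rw [zero_add] at h3
    refine h3.congr fun q => ?_
    simp only [Function.comp_apply, hq, map_sub, sub_add_cancel]

end CrossedProductMultipliers

/-! ### From representations of the crossed product back to covariant representations -/

section Correspondence

variable {𝕜 : Type v} [RCLike 𝕜]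
  {A : Type*} [NonUnitalNormedRing A] [NormedSpace 𝕜 A] [IsScalarTower 𝕜 A A]
  [SMulCommClass 𝕜 A A] [CompleteSpace A]
  {G : Type*} [Group G] [TopologicalSpace G] [IsTopologicalGroup G] [LocallyCompactSpace G]
  [T2Space G] [MeasurableSpace G] [BorelSpace G] (μ : Measure G) [μ.IsHaarMeasure]
  {α : DynSys 𝕜 A G} {R : UBClass.{v, w} α}
  {X : Type*} [NormedAddCommGroup X] [NormedSpace 𝕜 X] [CompleteSpace X]

/-- Every non-degenerate contractive representation of the crossed product is the integrated form
of a covariant representation. -/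
theorem UBClass.IsContractive.exists_covRep (hR : R.IsContractive)
    (hA : ∀ ε : ℝ, 0 < ε → HasApproxLeftId A (1 + ε))
    {T : CrossedProduct μ R →ₙₐ[𝕜] (X →L[𝕜] X)} (hT : Nondeg T) (hb : ∀ b, ‖T b‖ ≤ ‖b‖) :
    ∃ p : ContCovRep α X, Nondeg p.π ∧ (∀ a, ‖p.π a‖ ≤ ‖a‖) ∧ (∀ r, Isometry (p.U r)) ∧
      ∀ f, intForm μ p f = T (toCP μ R f) := by
  have hTc : Continuous T := AddMonoidHomClass.continuous_of_bound T 1 (by simpa using hb)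
  have hB : ∀ ε : ℝ, 0 < ε → HasApproxLeftId (CrossedProduct μ R) (1 + ε) :=
    fun ε hε => hR.hasApproxLeftId μ (hA ε hε)
  choose π hπ hπb using fun a => hT.exists_multiplier hB hb (cpMul μ hR a) (cpMul_mul μ hR a)
    (norm_nonneg a) (norm_cpMul_le μ hR a)
  choose U hU hUb using fun t => hT.exists_multiplier hB hb (cpTrans μ hR t) (cpTrans_mul μ hR t)
    zero_le_one (norm_cpTrans_le μ hR t)
  -- Read through `cpRep`, the multipliers already satisfy all the algebraic identities, which then
  -- pass to the vectors $T(b)x$.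
  have eπ : ∀ a, cpMul μ hR a = (cpRep μ hR).π a := fun _ => rfl
  have eU : ∀ t, cpTrans μ hR t = (cpRep μ hR).U t := fun _ => rfl
  have hUc : ∀ x, Continuous fun s => U s x := fun x => by
    rw [continuous_iff_continuousAt]
    intro t
    refine tendsto_of_dense_span (Eventually.of_forall hUb) hT ?_ x
    rintro _ ⟨b, y, rfl⟩
    simp only [hU]
    exact ((hTc.comp (continuous_cpTrans μ hR b)).clm_apply continuous_const).tendsto t
  let p : ContCovRep α X :=
    { π :=
        { toFun := π
          map_smul' := fun c a => hT.ext fun b x => by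
            simp [hπ, eπ, map_smul]
          map_zero' := hT.ext fun b x => by simp [hπ, eπ]
          map_add' := fun a a' => hT.ext fun b x => by simp [hπ, eπ, map_add]
          map_mul' := fun a a' => hT.ext fun b x => by simp [hπ, eπ, map_mul] }
      U :=
        { toFun := U
          map_one' := hT.ext fun b x => by simp [hU, eU]
          map_mul' := fun s t => hT.ext fun b x => by simp [hU, eU, map_mul] }
      covariant := fun a s => hT.ext fun b x => by
        change π (α.act s a) (T b x) = U s (π a (U s⁻¹ (T b x)))
        simp [hU, hπ, eπ, eU, (cpRep μ hR).covariant]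
      bounded := ⟨1, fun a => by rw [one_mul]; exact hπb a⟩
      continuous_U := hUc }
  have hpπ : ∀ a b x, p.π a (T b x) = T (cpMul μ hR a b) x := hπ
  have hpU : ∀ t b x, p.U t (T b x) = T (cpTrans μ hR t b) x := hU
  refine ⟨p, ?_, hπb, fun r => ?_, fun f => hT.ext fun b x => ?_⟩
  · rw [Nondeg, dense_iff_closure_eq, ← univ_subset_iff, ← hT.closure_eq]
    refine closure_minimal ?_ isClosed_closure
    rw [← Submodule.topologicalClosure_coe, SetLike.coe_subset_coe, Submodule.span_le]
    rintro _ ⟨b, x, rfl⟩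
    -- Any bounded approximate identity would do here: $\pi(u)T(b)x=T(ub)x\to T(b)x$ puts every
    -- $T(b)x$ in the closed span of the range of $\pi$.
    obtain ⟨l, hl, hM, hlim⟩ := hA 1 one_pos
    have h1 := ((hTc.clm_apply (continuous_const (y := x))).tendsto b).comp
      (tendsto_cpMul μ hR hM hlim b)
    exact mem_closure_of_tendsto h1
      (Eventually.of_forall fun u => Submodule.subset_span ⟨u, T b x, hpπ u b x⟩)
  -- An invertible contraction with contractive inverse is isometric.
  · refine (AddMonoidHomClass.isometry_iff_norm (p.U r)).2 fun x => le_antisymm ?_ ?_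
    · simpa using (p.U r).le_of_opNorm_le (hUb r) x
    · have := (p.U r⁻¹).le_of_opNorm_le (hUb r⁻¹) (p.U r x)
      rwa [U_inv_apply, one_mul] at this
  -- Applying `T` to the integral for $q^{\mathcal R}(f)b$ and evaluating at `x` gives
  -- $T(q^{\mathcal R}(f))T(b)x=\int\pi(f(s))U_sT(b)x\,ds$.
  · have h1 := intIntegrand (cpRep μ hR) f b
    have h2 := map_vint 𝕜 (μ := μ) ((ContinuousLinearMap.apply 𝕜 X x).comp
      (⟨(T : CrossedProduct μ R →ₗ[𝕜] (X →L[𝕜] X)), hTc⟩ :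
        CrossedProduct μ R →L[𝕜] (X →L[𝕜] X))) h1.1 h1.2
    have h3 : T (intForm μ (cpRep μ hR) f b) x =
        vint 𝕜 μ fun s => T (cpMul μ hR (f s) (cpTrans μ hR s b)) x := h2
    rw [intForm_cpRep, map_mul] at h3
    refine Eq.trans ?_ h3.symm
    rw [intForm_apply]
    simp only [hpU, hpπ]

theorem isClosed_setOf_invariant {B : Type*} [TopologicalSpace B] {T : B → (X →L[𝕜] X)}
    (hT : Continuous T) {Z : Submodule 𝕜 X} (hZ : IsClosed (Z : Set X)) :
    IsClosed {b | ∀ z ∈ Z, T b z ∈ Z} := by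
  simp only [ofPred_forall]
  exact isClosed_iInter fun z => isClosed_iInter fun _ =>
    hZ.preimage (hT.clm_apply continuous_const)

theorem invariant_intRep_iff {p : ContCovRep α X} (hp : IsRCont μ R p) {Z : Submodule 𝕜 X}
    (hZ : IsClosed (Z : Set X)) :
    Invariant (intForm μ p) Z ↔ Invariant (intRep μ hp) Z := by
  refine ⟨fun h b => (denseRange_toCP μ).induction_on b
    (isClosed_setOf_invariant (continuous_intRep μ hp) hZ) fun f => ?_, fun h f => ?_⟩
  · rw [← intRep_toCP μ hp]
    exact h _
  · rw [intRep_toCP]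
    exact h f

theorem intertwines_intRep_iff {Y : Type*} [NormedAddCommGroup Y] [NormedSpace 𝕜 Y]
    [CompleteSpace Y] {p : ContCovRep α X} (hp : IsRCont μ R p) {q : ContCovRep α Y}
    (hq : IsRCont μ R q) (Φ : X →L[𝕜] Y) :
    Intertwines (intForm μ p) (intForm μ q) Φ ↔
      Intertwines (intRep μ hp) (intRep μ hq) Φ := by
  refine ⟨fun h b => (denseRange_toCP μ).induction_on b
    (isClosed_eq ((continuous_intRep μ hq).clm_comp continuous_const)
      (continuous_const.clm_comp (continuous_intRep μ hp))) fun f => ?_, fun h f => ?_⟩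
  · rw [← intRep_toCP μ hp, ← intRep_toCP μ hq]
    exact h _
  · rw [intRep_toCP, intRep_toCP]
    exact h f

/-- A non-degenerate covariant representation is determined by its integrated form. -/
theorem covRep_ext_of_intForm {p q : ContCovRep α X} (hp : Nondeg p.π)
    (h : ∀ f, intForm μ p f = intForm μ q f) : p = q := by
  -- Equality of two representations on `X` means that the identity operator intertwines them.
  have h1 := (intertwines_intForm_iff μ (q := q) hp (ContinuousLinearMap.id 𝕜 X)).2 fun f => by
    rw [h f]
    rfl
  have hπ : p.π = q.π := NonUnitalAlgHom.ext fun a => (h1.1 a).symm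
  have hU : p.U = q.U := MonoidHom.ext fun t => (h1.2 t).symm
  obtain ⟨⟨π, U, _⟩, _, _⟩ := p
  obtain ⟨⟨ρ, V, _⟩, _, _⟩ := q
  obtain rfl : π = ρ := hπ
  obtain rfl : U = V := hU
  rfl

theorem isInvolutiveRep_intRep [StarRing A] [StarModule 𝕜 A] [ContinuousStar A]
    (hR : R.IsInvolutive) {p : ContCovRep α X} (hp : IsRCont μ R p)
    (hinv : p.toCovRep.IsInvolutive) : IsInvolutiveRep μ R (intRep μ hp) := by
  obtain ⟨h, rfl, hπ, hU⟩ := hinv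
  refine ⟨h, rfl, fun b x y => ?_⟩
  -- Continuity is built into the extension; involutivity of `R` enters through the values of
  -- `cpStar` on the image of $C_c(G,A)$.
  have hstar : Continuous (cpStar μ R) := UniformSpace.Completion.continuous_map
  refine (denseRange_toCP μ).induction_on (p := fun b =>
    h.inner (intRep μ hp (cpStar μ R b) x) y = h.inner x (intRep μ hp b y)) b ?_ fun f => ?_
  · refine isClosed_eq ?_ ?_
    · exact Continuous.inner (𝕜 := 𝕜) (((continuous_intRep μ hp).comp hstar).clm_apply
        continuous_const) continuous_const
    · exact Continuous.inner (𝕜 := 𝕜) continuous_const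
        ((continuous_intRep μ hp).clm_apply continuous_const)
  · rw [show cpStar μ R (toCP μ R f) = toCP μ R (ccStar α f) from cpStar_quot μ R hR f,
      intRep_toCP, intRep_toCP]
    exact inner_ccStar μ p h rfl hπ hU f x y

end Correspondence

/-! ### The bijection for the class of contractive and isometric pairs -/

section IsometricClass

variable {𝕜 : Type v} [RCLike 𝕜]
  {A : Type*} [NonUnitalNormedRing A] [NormedSpace 𝕜 A] [IsScalarTower 𝕜 A A]
  [SMulCommClass 𝕜 A A] [CompleteSpace A]
  {G : Type*} [Group G] [TopologicalSpace G] [IsTopologicalGroup G] [LocallyCompactSpace G]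
  [T2Space G] [MeasurableSpace G] [BorelSpace G] (μ : Measure G) [μ.IsHaarMeasure]
  {α : DynSys 𝕜 A G} {𝒳 : Set (BanachSp.{v, w} 𝕜)} (hne : (isomSet α 𝒳).Nonempty)

theorem isContractive_isomClass : (isomClass α 𝒳 hne).IsContractive := fun p hp => by
  refine ⟨hp.2.2.1, fun r => ContinuousLinearMap.opNorm_le_bound _ zero_le_one fun x => ?_⟩
  rw [one_mul]
  exact ((AddMonoidHomClass.isometry_iff_norm (p.2.U r)).1 (hp.2.2.2 r) x).le

theorem integration_bijOn (hA : ∀ ε : ℝ, 0 < ε → HasApproxLeftId A (1 + ε)) :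
    BijOn (integration μ (isomClass α 𝒳 hne)) univ
      {T : CPRep.{v, w} μ (isomClass α 𝒳 hne) | T.1 ∈ 𝒳 ∧ Nondeg T.2 ∧ ∀ b, ‖T.2 b‖ ≤ ‖b‖} := by
  have hR := isContractive_isomClass hne
  refine ⟨fun p _ => ⟨p.2.1, ?_, fun b => norm_intRep_le μ p.2 b⟩, ?_, ?_⟩
  · refine (nondeg_intForm μ p.1.2 p.2.2.1).mono (Submodule.span_mono ?_)
    rintro _ ⟨f, x, rfl⟩
    exact ⟨toCP μ _ f, x, by rw [← intRep_toCP μ (isRCont_of_mem μ p.2)]; rfl⟩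
  · rintro ⟨⟨X, p⟩, hp⟩ _ ⟨⟨Y, q⟩, hq⟩ _ h
    -- The representation space is part of the data, so equal images live on the same space, where
    -- `covRep_ext_of_intForm` applies.
    obtain ⟨rfl, h2⟩ := Sigma.mk.inj h
    obtain rfl : p = q := covRep_ext_of_intForm μ hp.2.1 fun f => by
      rw [← intRep_toCP μ (isRCont_of_mem μ hp), ← intRep_toCP μ (isRCont_of_mem μ hq)]
      exact DFunLike.congr_fun (eq_of_heq h2) _
    rfl
  · rintro ⟨X, T⟩ ⟨hX, hT, hb⟩
    obtain ⟨p, h1, h2, h3, h4⟩ := hR.exists_covRep μ hA hT hb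
    have hp : (⟨X, p⟩ : Σ X : BanachSp.{v, w} 𝕜, ContCovRep α X) ∈ (isomClass α 𝒳 hne).carrier :=
      ⟨hX, h1, h2, h3⟩
    refine ⟨⟨⟨X, p⟩, hp⟩, mem_univ _, ?_⟩
    have hTc : Continuous T := AddMonoidHomClass.continuous_of_bound T 1 (by simpa using hb)
    have : intRep μ (isRCont_of_mem μ hp) = T := NonUnitalAlgHom.ext fun b =>
      (denseRange_toCP μ).induction_on b (isClosed_eq (continuous_intRep μ _) hTc) fun f => by
        rw [intRep_toCP, h4]
    exact congrArg (Sigma.mk X) this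

end IsometricClass

end CrossedProd

theorem theoremt {𝕜 : Type v} [RCLike 𝕜]
    {A : Type*} [NonUnitalNormedRing A] [NormedSpace 𝕜 A] [IsScalarTower 𝕜 A A]
    [SMulCommClass 𝕜 A A] [CompleteSpace A]
    {G : Type*} [Group G] [TopologicalSpace G] [IsTopologicalGroup G] [LocallyCompactSpace G]
    [T2Space G] [MeasurableSpace G] [BorelSpace G] (μ : Measure G) [μ.IsHaarMeasure]
    (α : CrossedProd.DynSys 𝕜 A G)
    (hA : ∀ ε : ℝ, 0 < ε → CrossedProd.HasApproxLeftId A (1 + ε))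
    (𝒳 : Set (CrossedProd.BanachSp.{v, w} 𝕜)) (hne : (CrossedProd.isomSet α 𝒳).Nonempty) :
    let R := CrossedProd.isomClass α 𝒳 hne
    Set.BijOn (CrossedProd.integration μ R) Set.univ
      {T : CrossedProd.CPRep.{v, w} μ R |
        T.1 ∈ 𝒳 ∧ CrossedProd.Nondeg T.2 ∧ ∀ b, ‖T.2 b‖ ≤ ‖b‖} ∧
    (∀ (p : R.carrier) (Z : Submodule 𝕜 p.1.1), IsClosed (Z : Set p.1.1) →
      (CrossedProd.Invariant p.1.2.π Z ∧ CrossedProd.Invariant p.1.2.U Z ↔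
        CrossedProd.Invariant (CrossedProd.integration μ R p).2 Z)) ∧
    (∀ (p q : R.carrier) (Φ : p.1.1 →L[𝕜] q.1.1),
      CrossedProd.Intertwines p.1.2.π q.1.2.π Φ ∧ CrossedProd.Intertwines p.1.2.U q.1.2.U Φ ↔
        CrossedProd.Intertwines (CrossedProd.integration μ R p).2
          (CrossedProd.integration μ R q).2 Φ) ∧
    (∀ [StarRing A] [StarModule 𝕜 A] [ContinuousStar A], α.IsInvolutive → R.IsInvolutive →
      ∀ p : R.carrier, p.1.2.IsInvolutive ↔
        CrossedProd.IsInvolutiveRep μ R (CrossedProd.integration μ R p).2) := by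
  intro R
  refine ⟨CrossedProd.integration_bijOn μ hne hA, fun p Z hZ => ?_, fun p q Φ => ?_, ?_⟩
  · obtain ⟨l, hl, hM, hlim⟩ := hA 1 one_pos
    have hc := p.1.2.continuous_π
    refine (CrossedProd.invariant_intForm_iff μ ⟨l, hl, fun x => ?_⟩ hZ).trans
      (CrossedProd.invariant_intRep_iff μ (CrossedProd.isRCont_of_mem μ p.2) hZ)
    exact p.2.2.1.tendsto_approx (map_mul p.1.2.π) p.2.2.2.1 hc hM hlim x
  · exact (CrossedProd.intertwines_intForm_iff μ p.2.2.1 Φ).trans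
      (CrossedProd.intertwines_intRep_iff μ (CrossedProd.isRCont_of_mem μ p.2)
        (CrossedProd.isRCont_of_mem μ q.2) Φ)
  · intro _ _ _ _ hinv p
    exact ⟨CrossedProd.isInvolutiveRep_intRep μ hinv (CrossedProd.isRCont_of_mem μ p.2),
      -- By surjectivity, involutive representations of the crossed product come from members of
      -- `R`, and these are involutive by assumption.
      fun _ => hinv p.1 p.2⟩
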